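/- Let $n,K\ge 1$, let $P\in[0,1]^{K\times K}$ be symmetric and $z\in[K]^n$. In the stochastic block model (SBM) with labels $z$ and connectivity matrix $P$, the adjacency matrix $A\in\{0,1\}^{n\times n}$ is symmetric with $A_{ii}=0$, and its entries $A_{ij}\sim\mathrm{Bern}(P_{z_iz_j})$, $i>j$, are independent. Write $p_{aj}:=P_{az_j}$, $p_{a*}:=(p_{a1},\dots,p_{an})$, $n_a:=|\{j: z_j=a\}|$ and $p^*:=\max_{a,b}P_{ab}$. For vectors $p,q$ with entries in $[0,1]$, let $\varphi_p$ denote the probability mass function of $\bigotimes_j\mathrm{Bern}(p_j)$, and let $$\eta(p,q)=\sum_x\min(\varphi_p(x),\varphi_q(x)),\qquad D^*(p,q)=\sup_{\alpha\in(0,1)}\Big(-\log\sum_x\varphi_p(x)^{1-\alpha}\varphi_q(x)^{\alpha}\Big)$$ be the total variation affinity and the Chernoff information. Fix a node $i$ and two labels $k\ne\ell$ with $z_i\in\{k,\ell\}$. Suppose that $P$ and all labels except $z_i$ are known and that the label of node $i$ is $k$ or $\ell$ with probability $\tfrac12$ each. Let $\hat z_i=\hat z_i(A)$ be a Bayes (maximum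 likelihood) estimator, $$\hat z_i\in\arg\max_{a\in\{k,\ell\}}\sum_{j\ne i}A_{ij}\log p_{aj}+(1-A_{ij})\log(1-p_{aj}),$$ with ties broken arbitrarily, $\log 0=-\infty$ and $0\cdot(-\infty)=0$. Let $\mathbb P(\hat z_i\ne z_i)$ be its error probability under this uniform prior on the label of node $i$. In the definition of $p_{a*}$ and $n_a$, $z_i$ may be either of the two candidate values. (a) $\mathbb P(\hat z_i\ne z_i)=\tfrac12\,\eta\big((p_{kj})_{j\ne i},(p_{\ell j})_{j\ne i}\big)$. Moreover, if $p^*\le 1-\varepsilon$ with $\varepsilon>0$, then $$\tfrac12\,\eta(p_{k*},p_{\ell*})\le\mathbb P(\hat z_i\ne z_i)\le\tfrac{1}{2\varepsilon}\,\eta(p_{k*},p_{\ell*}).$$ (b) Let $\beta>1$, $\varepsilon\in(0,1)$, $\omega>1$ and $K^*\in\mathbb N$. There are constants $C_1,C_2,c_1,c_2>0$ that depend only on $\beta,\varepsilon,\omega,K^*$ such that the following holds for all $n,K,P,z,i,k,\ell,\hat z_i$ as above with $K\le K^*$. Suppose that $$\frac{n}{\beta K}\le n_a\le\frac{\beta n}{K}\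 \ (a\in[K]),\qquad p^*\le 1-\varepsilon,\qquad \min_{a,b}P_{ab}>0,\qquad \frac{\max_{a,b}P_{ab}}{\min_{a,b}P_{ab}}\le\omega .$$ If $C_1\le np^*\le C_2\,D^*(p_{k*},p_{\ell*})^2$, then $$c_1R\le\mathbb P(\hat z_i\ne z_i)\le c_2R,\qquad R:=\Big(\sqrt{np^*}\,\max_{j\in[n]}\Big|\log\frac{p_{kj}(1-p_{\ell j})}{p_{\ell j}(1-p_{kj})}\Big|\Big)^{-1}\exp\big(-D^*(p_{k*},p_{\ell*})\big).$$ -/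

import Mathlib

noncomputable section

/-- Total variation affinity `∫ min(φ₀, φ₁) dμ` of two mass functions on a finite set, with
respect to the counting measure. -/
def tvAffinity {Ω : Type*} [Fintype Ω] (φ₀ φ₁ : Ω → ℝ) : ℝ :=
  ∑ x, min (φ₀ x) (φ₁ x)

/-- Chernoff `α`-divergence `-log ∫ φ₀^(1-α) φ₁^α dμ`. -/
def chernoffDiv {Ω : Type*} [Fintype Ω] (α : ℝ) (φ₀ φ₁ : Ω → ℝ) : ℝ :=
  -Real.log (∑ x, φ₀ x ^ (1 - α) * φ₁ x ^ α)

/-- Chernoff information: the supremum over `α ∈ (0,1)` of the Chernoff `α`-divergence. -/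
def chernoffInfo {Ω : Type*} [Fintype Ω] (φ₀ φ₁ : Ω → ℝ) : ℝ :=
  ⨆ α : Set.Ioo (0 : ℝ) 1, chernoffDiv (α : ℝ) φ₀ φ₁

/-- Mass function of `⨂ⱼ Bern(pⱼ)`: independent coordinates, the `j`-th one being `true` (that is,
`1`) with probability `p j`. -/
def bernPMF {ι : Type*} [Fintype ι] (p : ι → ℝ) (x : ι → Bool) : ℝ :=
  ∏ j, if x j then p j else 1 - p j

/-- The vector `p_{a*} = (P_{a z_1}, …, P_{a z_n})`. -/
def paramVec {n K : ℕ} (P : Matrix (Fin K) (Fin K) ℝ) (z : Fin n → Fin K) (a : Fin K) :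
    Fin n → ℝ :=
  fun j => P a (z j)

/-- The same vector without its `i`-th entry. -/
def paramVecErase {n K : ℕ} (P : Matrix (Fin K) (Fin K) ℝ) (z : Fin n → Fin K) (i : Fin n)
    (a : Fin K) : {j : Fin n // j ≠ i} → ℝ :=
  fun j => P a (z j)

/-- Unordered pairs of distinct nodes, written as `(i, j)` with `j < i`. -/
abbrev NodePair (n : ℕ) : Type := {e : Fin n × Fin n // e.2 < e.1}

/-- The adjacency matrix with `A i j = A j i = w (i, j)` for `j < i` and zero diagonal. -/
def adjOfPairs {n : ℕ} (w : NodePair n → Bool) : Matrix (Fin n) (Fin n) Bool :=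
  fun i j => if h : j < i then w ⟨(i, j), h⟩ else if h : i < j then w ⟨(j, i), h⟩ else false

/-- Probability of the event `S` for the adjacency matrix of the stochastic block model with labels
`z` and connectivity matrix `P`: the entries below the diagonal are independent,
`A i j ∼ Bern(P_{z_i z_j})`. -/
def sbmProb {n K : ℕ} (P : Matrix (Fin K) (Fin K) ℝ) (z : Fin n → Fin K)
    (S : Set (Matrix (Fin n) (Fin n) Bool)) : ℝ :=
  ∑ w : NodePair n → Bool,
    bernPMF (fun e : NodePair n => P (z e.1.1) (z e.1.2)) w *
      S.indicator (fun _ => (1 : ℝ)) (adjOfPairs w)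

/-- Log-likelihood of label `a` for node `i`,
`∑_{j ≠ i} A_{ij} log p_{aj} + (1 - A_{ij}) log (1 - p_{aj})`, valued in the extended reals with
`log 0 = -∞` and `0 · (-∞) = 0`. -/
def nodeLogLik {n K : ℕ} (P : Matrix (Fin K) (Fin K) ℝ) (z : Fin n → Fin K) (i : Fin n)
    (A : Matrix (Fin n) (Fin n) Bool) (a : Fin K) : EReal :=
  ∑ j ∈ Finset.univ.erase i,
    if A i j then ENNReal.log (ENNReal.ofReal (P a (z j)))
    else ENNReal.log (ENNReal.ofReal (1 - P a (z j)))

/-- `zhat` is a Bayes (maximum likelihood) estimator of the label of node `i` between the two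
candidates `k` and `l`; ties may be broken in any way. -/
def IsBayesEstimator {n K : ℕ} (P : Matrix (Fin K) (Fin K) ℝ) (z : Fin n → Fin K) (i : Fin n)
    (k l : Fin K) (zhat : Matrix (Fin n) (Fin n) Bool → Fin K) : Prop :=
  ∀ A, (zhat A = k ∨ zhat A = l) ∧
    ∀ a, a = k ∨ a = l → nodeLogLik P z i A a ≤ nodeLogLik P z i A (zhat A)

/-- Error probability `ℙ(zhat(A) ≠ z_i)` when `z_i` is `k` or `l` with probability `1/2` each, the
other labels are those of `z`, and `A` is drawn from the block model given all the labels. -/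
def labelError {n K : ℕ} (P : Matrix (Fin K) (Fin K) ℝ) (z : Fin n → Fin K) (i : Fin n)
    (k l : Fin K) (zhat : Matrix (Fin n) (Fin n) Bool → Fin K) : ℝ :=
  (1 / 2) * sbmProb P (Function.update z i k) {A | zhat A ≠ k} +
    (1 / 2) * sbmProb P (Function.update z i l) {A | zhat A ≠ l}

/-- The largest entry `p^*` of `P`. -/
def maxEntry {K : ℕ} (P : Matrix (Fin K) (Fin K) ℝ) : ℝ :=
  ⨆ e : Fin K × Fin K, P e.1 e.2

/-- The smallest entry of `P`. -/
def minEntry {K : ℕ} (P : Matrix (Fin K) (Fin K) ℝ) : ℝ :=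
  ⨅ e : Fin K × Fin K, P e.1 e.2

/-- Number of nodes with label `a`. -/
def classSize {n K : ℕ} (z : Fin n → Fin K) (a : Fin K) : ℕ :=
  (Finset.univ.filter fun j => z j = a).card

/-- Balanced communities, `p^* ≤ 1 - ε`, and entries of `P` comparable up to the factor `ω`. -/
structure BlockRegular {n K : ℕ} (β ε ω : ℝ) (P : Matrix (Fin K) (Fin K) ℝ)
    (z : Fin n → Fin K) : Prop where
  size_lower : ∀ a, (n : ℝ) / (β * K) ≤ classSize z a
  size_upper : ∀ a, (classSize z a : ℝ) ≤ β * n / K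
  max_le : maxEntry P ≤ 1 - ε
  min_pos : 0 < minEntry P
  ratio_le : maxEntry P / minEntry P ≤ ω

/-- `max_j |log (p_j (1 - q_j) / (q_j (1 - p_j)))|`. -/
def maxLogOdds {n : ℕ} (p q : Fin n → ℝ) : ℝ :=
  ⨆ j, |Real.log (p j * (1 - q j) / (q j * (1 - p j)))|

/-- `(√(n p^*) · max_j |log-odds ratio|)⁻¹ · exp(-D^*(p_{k*}, p_{l*}))`. -/
def errorRate {n K : ℕ} (P : Matrix (Fin K) (Fin K) ℝ) (z : Fin n → Fin K) (k l : Fin K) : ℝ :=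
  (Real.sqrt (n * maxEntry P) * maxLogOdds (paramVec P z k) (paramVec P z l))⁻¹ *
    Real.exp (-chernoffInfo (bernPMF (paramVec P z k)) (bernPMF (paramVec P z l)))

end

/-! Part (a). Changing the label of `i` changes only the law of row `i`, and the Bayes rule errs
with the smaller of the two row likelihoods, so the error is half an affinity (`labelError_eq`).
Adding the coordinate `i` can only decrease the affinity, since dropping it is marginalization; and
the outcome `false` there, of probability at least `ε` under both laws, retains a fraction `ε` of
it.

Part (b). Let `L` be the log-likelihood ratio of `q` to `p` and `Λ(a)` the logarithm of the Chernoff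
coefficient. `Λ` vanishes at `0` and `1`; at a critical point `a` in between, `D^* = -Λ(a)` and `L`
has mean zero under the tilted law, again a Bernoulli product. Then `min(φ_p, φ_q) = e^{-D^*} φ_tilt
exp(-max(aL, (a-1)L))` (`bernPMF_min_eq`). Two-sided bounds on `Λ''`, the tilted variance of `L`,
keep `a` away from `0` and `1` (`critical_mem`), so what remains is a tilted mean of `exp(-κ|L|)`,
with `κ` of order one.

That mean is of order `1/(s|λ|)`, where `λ` is the largest log-odds ratio in absolute value. A
positive fraction of the nodes share the label of a maximizing node; given the other coordinates,
`L` is `λ` times a centred binomial variable plus a constant. Binomial weights are at most of order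
`1/s`, with `s` the standard deviation, and at least of that order in the bulk (`binomWeight_le`,
`le_binomWeight`); the exponential selects about `1/|λ|` lattice points. Here `s` is of order
`√(np^*)`, and `np^* ≤ D^*²` forces `|λ| s ≥ 1`, so that these points fit inside the bulk.

The weight bounds need no Stirling formula: consecutive weights have explicit ratios, and total mass
and Chebyshev's inequality fix the scale. -/

noncomputable section

open Finset

/-! ### Product Bernoulli mass functions -/

section BernPMF

variable {ι : Type*} [Fintype ι]

theorem bernPMF_nonneg {p : ι → ℝ} (hp : ∀ j, 0 ≤ p j ∧ p j ≤ 1) (x : ι → Bool) :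
    0 ≤ bernPMF p x := by
  refine Finset.prod_nonneg fun j _ => ?_
  split_ifs
  · exact (hp j).1
  · linarith [(hp j).2]

theorem bernPMF_pos {p : ι → ℝ} (hp : ∀ j, 0 < p j ∧ p j < 1) (x : ι → Bool) :
    0 < bernPMF p x := by
  refine Finset.prod_pos fun j _ => ?_
  split_ifs
  · exact (hp j).1
  · linarith [(hp j).2]

theorem bernPMF_sumElim {α β : Type*} [Fintype α] [Fintype β] (e : ι ≃ α ⊕ β) (p : ι → ℝ)
    (u : α → Bool) (v : β → Bool) :
    bernPMF p (fun j => Sum.elim u v (e j)) =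
      bernPMF (fun a => p (e.symm (Sum.inl a))) u * bernPMF (fun b => p (e.symm (Sum.inr b))) v := by
  unfold bernPMF
  rw [← Equiv.prod_comp e.symm, Fintype.prod_sum_type]
  simp

variable [DecidableEq ι]

theorem sum_prod_bool (g : ι → Bool → ℝ) :
    ∑ x : ι → Bool, ∏ j, g j (x j) = ∏ j, (g j true + g j false) := by
  have h := Finset.prod_univ_sum (fun _ : ι => (Finset.univ : Finset Bool)) g
  rw [Fintype.piFinset_univ] at h
  rw [← h]
  exact Finset.prod_congr rfl fun j _ => Fintype.sum_bool _

theorem sum_bernPMF_mul_prod (p : ι → ℝ) (g : ι → Bool → ℝ) :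
    ∑ x, bernPMF p x * ∏ j, g j (x j) = ∏ j, (p j * g j true + (1 - p j) * g j false) := by
  have := sum_prod_bool fun j b => (if b then p j else 1 - p j) * g j b
  simp only [Finset.prod_mul_distrib, if_true, Bool.false_eq_true, if_false] at this
  exact this

theorem sum_bernPMF (p : ι → ℝ) : ∑ x, bernPMF p x = 1 := by
  simpa using sum_bernPMF_mul_prod p fun _ _ => 1

/-- Splitting the coordinates into two independent blocks. -/
theorem sum_boolFun_split {α β : Type*} [Fintype α] [Fintype β]
    [DecidableEq α] [DecidableEq β] (e : ι ≃ α ⊕ β)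
    (F : (ι → Bool) → ℝ) :
    ∑ x, F x = ∑ u : α → Bool, ∑ v : β → Bool, F (fun j => Sum.elim u v (e j)) := by
  rw [← Fintype.sum_prod_type']
  refine (Fintype.sum_equiv
    ((Equiv.sumArrowEquivProdArrow α β Bool).symm.trans (Equiv.arrowCongr e.symm (Equiv.refl Bool)))
    _ _ fun x => ?_).symm
  congr 1

theorem sum_bernPMF_split {α β : Type*} [Fintype α] [Fintype β]
    [DecidableEq α] [DecidableEq β] (e : ι ≃ α ⊕ β) (p : ι → ℝ)
    (F : (ι → Bool) → ℝ) :
    ∑ x, bernPMF p x * F x = ∑ v : β → Bool, bernPMF (fun b => p (e.symm (Sum.inr b))) v *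
      ∑ u : α → Bool, bernPMF (fun a => p (e.symm (Sum.inl a))) u *
        F (fun j => Sum.elim u v (e j)) := by
  rw [sum_boolFun_split e, Finset.sum_comm]
  refine Finset.sum_congr rfl fun v _ => ?_
  rw [Finset.mul_sum]
  refine Finset.sum_congr rfl fun u _ => ?_
  rw [bernPMF_sumElim]
  ring

/-- Second moment of a linear statistic with centred independent summands. -/
theorem sum_bernPMF_mul_sq (p c : ι → ℝ) :
    ∑ x, bernPMF p x * (∑ j, c j * ((if x j then 1 else 0) - p j)) ^ 2 =
      ∑ j, c j ^ 2 * (p j * (1 - p j)) := by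
  have key : ∀ i j : ι, ∑ x, bernPMF p x *
      ((c i * ((if x i then 1 else 0) - p i)) * (c j * ((if x j then 1 else 0) - p j))) =
      if i = j then c i ^ 2 * (p i * (1 - p i)) else 0 := by
    intro i j
    -- The product of the two summands is written as a product over all coordinates, with factor `1`
    -- away from `i` and `j`, so that its mean factorizes.
    have h := sum_bernPMF_mul_prod p fun k b =>
      (if k = i then c i * ((if b then 1 else 0) - p i) else 1) *
        (if k = j then c j * ((if b then 1 else 0) - p j) else 1)
    have e1 : ∀ x : ι → Bool, ∏ k, ((if k = i then c i * ((if x k then (1 : ℝ) else 0) - p i) else 1) *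
        (if k = j then c j * ((if x k then 1 else 0) - p j) else 1)) =
        (c i * ((if x i then 1 else 0) - p i)) * (c j * ((if x j then 1 else 0) - p j)) := by
      intro x
      rw [Finset.prod_mul_distrib, Finset.prod_ite_eq' , Finset.prod_ite_eq']
      simp
    simp only [e1] at h
    rw [h]
    by_cases hij : i = j
    · subst hij
      rw [if_pos rfl, Finset.prod_eq_single i]
      · simp only [if_true, Bool.false_eq_true, if_false]; ring
      · intro k _ hk; simp [hk]
      · simp
    · rw [if_neg hij]
      refine Finset.prod_eq_zero (Finset.mem_univ i) ?_
      simp only [if_true, Bool.false_eq_true, if_false, if_neg hij]; ring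
  have : ∀ x : ι → Bool, bernPMF p x * (∑ j, c j * ((if x j then 1 else 0) - p j)) ^ 2 =
      ∑ i, ∑ j, bernPMF p x *
      ((c i * ((if x i then 1 else 0) - p i)) * (c j * ((if x j then 1 else 0) - p j))) := by
    intro x
    rw [sq, Finset.sum_mul_sum, Finset.mul_sum]
    exact Finset.sum_congr rfl fun i _ => Finset.mul_sum _ _ _
  simp only [this]
  rw [Finset.sum_comm]
  refine Finset.sum_congr rfl fun i _ => ?_
  rw [Finset.sum_comm]
  simp only [key]
  simp

/-- Chebyshev: half of the mass lies within `√2` standard deviations. -/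
theorem bernPMF_chebyshev {p : ι → ℝ} (hp : ∀ j, 0 ≤ p j ∧ p j ≤ 1) (c : ι → ℝ) {T : ℝ} (hT : 0 < T)
    (h : 2 * ∑ j, c j ^ 2 * (p j * (1 - p j)) ≤ T ^ 2) :
    1 / 2 ≤ ∑ x with |∑ j, c j * ((if x j then 1 else 0) - p j)| ≤ T, bernPMF p x := by
  have h1 := sum_bernPMF_mul_sq p c
  have h2 : ∑ x with ¬ |∑ j, c j * ((if x j then 1 else 0) - p j)| ≤ T, bernPMF p x ≤ 1 / 2 := by
    have : T ^ 2 * ∑ x with ¬ |∑ j, c j * ((if x j then 1 else 0) - p j)| ≤ T, bernPMF p x ≤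
        ∑ x, bernPMF p x * (∑ j, c j * ((if x j then 1 else 0) - p j)) ^ 2 := by
      rw [Finset.mul_sum]
      refine (Finset.sum_le_sum fun x hx => ?_).trans
        (Finset.sum_le_sum_of_subset_of_nonneg (Finset.filter_subset _ _) fun x _ _ =>
          mul_nonneg (bernPMF_nonneg hp x) (sq_nonneg _))
      rw [mul_comm]
      refine mul_le_mul_of_nonneg_left ?_ (bernPMF_nonneg hp x)
      rw [← sq_abs (∑ j, _)]
      have := not_le.1 (Finset.mem_filter.1 hx).2
      gcongr
    have hT2 : 0 < T ^ 2 := by positivity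
    by_contra hcon
    nlinarith
  have h3 := Finset.sum_filter_add_sum_filter_not Finset.univ
    (fun x : ι → Bool => |∑ j, c j * ((if x j then 1 else 0) - p j)| ≤ T) (bernPMF p)
  rw [sum_bernPMF] at h3
  linarith

/-- The number of successes in constant-parameter trials is binomial. -/
theorem sum_bernPMF_const (r : ℝ) (G : ℕ → ℝ) :
    ∑ x : ι → Bool, bernPMF (fun _ => r) x * G (#{j | x j = true}) =
      ∑ y ∈ range (Fintype.card ι + 1),
        (Fintype.card ι).choose y * r ^ y * (1 - r) ^ (Fintype.card ι - y) * G y := by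
  let e : (ι → Bool) ≃ Finset ι :=
    { toFun := fun x => univ.filter fun j => x j = true
      invFun := fun s j => decide (j ∈ s)
      left_inv := fun x => by ext j; simp
      right_inv := fun s => by ext j; simp }
  have h1 : ∀ x : ι → Bool, bernPMF (fun _ => r) x =
      r ^ #{j | x j = true} * (1 - r) ^ (Fintype.card ι - #{j | x j = true}) := by
    intro x
    unfold bernPMF
    rw [Finset.prod_ite, Finset.prod_const, Finset.prod_const, Finset.filter_not,
      Finset.card_sdiff_of_subset (Finset.filter_subset _ _), Finset.card_univ]
  rw [Fintype.sum_equiv e _ (fun s => r ^ #s * (1 - r) ^ (Fintype.card ι - #s) * G #s)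
    (fun x => by rw [h1]; rfl), ← Finset.powerset_univ,
    Finset.sum_powerset_apply_card (fun m => r ^ m * (1 - r) ^ (Fintype.card ι - m) * G m),
    Finset.card_univ]
  refine Finset.sum_congr rfl fun y _ => ?_
  rw [nsmul_eq_mul]; ring

end BernPMF

/-! ### Bayes error in the block model -/

section Bayes

variable {n K : ℕ}

/-- The pairs of nodes are the pairs that contain `i`, indexed by the other node, and the rest. -/
def nodePairEquiv (i : Fin n) :
    NodePair n ≃ {j : Fin n // j ≠ i} ⊕ {e : NodePair n // ¬ (e.1.1 = i ∨ e.1.2 = i)} where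
  toFun e :=
    if h : e.1.1 = i ∨ e.1.2 = i then
      if h1 : e.1.1 = i then Sum.inl ⟨e.1.2, fun h2 => by
        have := e.2; rw [h1, h2] at this; exact lt_irrefl _ this⟩
      else Sum.inl ⟨e.1.1, h1⟩
    else Sum.inr ⟨e, h⟩
  invFun := Sum.elim
    (fun j => if h : j.1 < i then ⟨(i, j.1), h⟩
      else ⟨(j.1, i), lt_of_le_of_ne (not_lt.1 h) (Ne.symm j.2)⟩)
    (fun e => e.1)
  left_inv := by
    rintro ⟨⟨a, b⟩, hab⟩
    simp only at hab
    by_cases h : a = i ∨ b = i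
    · by_cases h1 : a = i
      · subst h1
        simp [hab]
      · have hb : b = i := h.resolve_left h1
        subst hb
        simp [h1, not_lt.2 hab.le]
    · simp [h]
  right_inv := by
    rintro (⟨j, hj⟩ | ⟨e, he⟩)
    · by_cases h : j < i
      · simp [h]
      · simp [h, hj]
    · simp [he]

theorem adjOfPairs_nodePairEquiv (i : Fin n) (u : {j : Fin n // j ≠ i} → Bool)
    (v : {e : NodePair n // ¬ (e.1.1 = i ∨ e.1.2 = i)} → Bool) (j : {j : Fin n // j ≠ i}) :
    adjOfPairs (fun e => Sum.elim u v (nodePairEquiv i e)) i j = u j := by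
  obtain ⟨j, hj⟩ := j
  unfold adjOfPairs
  by_cases h : j < i
  · simp [h, nodePairEquiv]
  · have h' : i < j := lt_of_le_of_ne (not_lt.1 h) (Ne.symm hj)
    simp [h, h', nodePairEquiv, hj]

/-- The second factor does not involve `a`: only row `i` carries information on the label. Symmetry
of `P` handles the pairs in which `i` is the smaller node. -/
theorem bernPMF_nodePairs {P : Matrix (Fin K) (Fin K) ℝ} (hP : P.IsSymm) (z : Fin n → Fin K)
    (i : Fin n) (a : Fin K) (u : {j : Fin n // j ≠ i} → Bool)
    (v : {e : NodePair n // ¬ (e.1.1 = i ∨ e.1.2 = i)} → Bool) :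
    bernPMF (fun e : NodePair n => P (Function.update z i a e.1.1) (Function.update z i a e.1.2))
        (fun e => Sum.elim u v (nodePairEquiv i e)) =
      bernPMF (paramVecErase P z i a) u *
        bernPMF (fun e : {e : NodePair n // ¬ (e.1.1 = i ∨ e.1.2 = i)} =>
          P (z e.1.1.1) (z e.1.1.2)) v := by
  rw [bernPMF_sumElim]
  congr 2
  · funext j
    obtain ⟨j, hj⟩ := j
    by_cases h : j < i
    · simp [nodePairEquiv, h, paramVecErase, hj]
    · simp [nodePairEquiv, h, paramVecErase, hj, hP.apply]
  · funext e
    obtain ⟨e, he⟩ := e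
    push Not at he
    simp [nodePairEquiv, he.1, he.2]

theorem ennreal_log_prod {ι : Type*} (s : Finset ι) (f : ι → ENNReal) :
    ENNReal.log (∏ j ∈ s, f j) = ∑ j ∈ s, ENNReal.log (f j) := by
  classical
  induction s using Finset.induction_on with
  | empty => simp
  | insert a s ha ih => rw [Finset.prod_insert ha, Finset.sum_insert ha, ENNReal.log_mul_add, ih]

/-- The extended logarithm turns products into sums even at zero, so comparing log-likelihoods
amounts to comparing masses, without positivity of `P`. -/
theorem nodeLogLik_eq {P : Matrix (Fin K) (Fin K) ℝ} (h01 : ∀ a b, 0 ≤ P a b ∧ P a b ≤ 1)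
    (z : Fin n → Fin K) (i : Fin n) (A : Matrix (Fin n) (Fin n) Bool) (a : Fin K) :
    nodeLogLik P z i A a =
      ENNReal.log (ENNReal.ofReal (bernPMF (paramVecErase P z i a) fun j => A i j)) := by
  unfold nodeLogLik bernPMF
  rw [ENNReal.ofReal_prod_of_nonneg, ennreal_log_prod,
    Finset.sum_subtype (p := fun j => j ≠ i) _ (by simp)]
  · refine Finset.sum_congr rfl fun j _ => ?_
    split_ifs <;> rfl
  · intro j _
    have := h01 a (z j)
    split_ifs
    · exact this.1
    · exact sub_nonneg.2 this.2

/-- The Bayes error is half of the affinity of the laws of the row of node `i`. -/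
theorem labelError_eq {P : Matrix (Fin K) (Fin K) ℝ} {z : Fin n → Fin K} {i : Fin n} {k l : Fin K}
    {zhat : Matrix (Fin n) (Fin n) Bool → Fin K} (hP : P.IsSymm)
    (h01 : ∀ a b, 0 ≤ P a b ∧ P a b ≤ 1) (hkl : k ≠ l) (hz : IsBayesEstimator P z i k l zhat) :
    labelError P z i k l zhat =
      (1 / 2) * tvAffinity (bernPMF (paramVecErase P z i k)) (bernPMF (paramVecErase P z i l)) := by
  unfold labelError sbmProb
  rw [← mul_add, ← Finset.sum_add_distrib, sum_boolFun_split (nodePairEquiv i)]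
  congr 1
  unfold tvAffinity
  refine Finset.sum_congr rfl fun u _ => ?_
  -- The entries outside row `i` have total mass one; the minimum is spread over them to allow a
  -- termwise comparison.
  have hv := congrArg (fun t => min (bernPMF (paramVecErase P z i k) u)
    (bernPMF (paramVecErase P z i l) u) * t)
    (sum_bernPMF (fun e : {e : NodePair n // ¬ (e.1.1 = i ∨ e.1.2 = i)} =>
      P (z e.1.1.1) (z e.1.1.2)))
  simp only [mul_one] at hv
  rw [← hv, Finset.mul_sum]
  refine Finset.sum_congr rfl fun v _ => ?_
  rw [bernPMF_nodePairs hP, bernPMF_nodePairs hP]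
  obtain ⟨h1, h2⟩ := hz (adjOfPairs fun e => Sum.elim u v (nodePairEquiv i e))
  have hk := h2 k (Or.inl rfl)
  have hl := h2 l (Or.inr rfl)
  have hnn : ∀ a, 0 ≤ bernPMF (paramVecErase P z i a) u :=
    fun a => bernPMF_nonneg (fun j => h01 _ _) u
  simp only [nodeLogLik_eq h01, adjOfPairs_nodePairEquiv, ENNReal.log_le_log_iff,
    ENNReal.ofReal_le_ofReal_iff (hnn _)] at hk hl
  -- For each outcome exactly one of the two indicators is nonzero: that of the rejected label,
  -- whose row mass is the smaller.
  rcases h1 with h1 | h1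
  · rw [h1] at hl
    simp [h1, hkl, min_eq_right hl]
  · rw [h1] at hk
    simp [h1, hkl.symm, min_eq_left hk]

theorem le_maxEntry (P : Matrix (Fin K) (Fin K) ℝ) (a b : Fin K) : P a b ≤ maxEntry P :=
  le_ciSup (f := fun e : Fin K × Fin K => P e.1 e.2) (Set.finite_range _).bddAbove (a, b)

theorem minEntry_le (P : Matrix (Fin K) (Fin K) ℝ) (a b : Fin K) : minEntry P ≤ P a b :=
  ciInf_le (f := fun e : Fin K × Fin K => P e.1 e.2) (Set.finite_range _).bddBelow (a, b)

variable (P : Matrix (Fin K) (Fin K) ℝ) (z : Fin n → Fin K) (i : Fin n) (k l : Fin K)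

theorem tvAffinity_paramVec : tvAffinity (bernPMF (paramVec P z k)) (bernPMF (paramVec P z l)) =
    ∑ u, ∑ v : {j : Fin n // ¬ j ≠ i} → Bool,
      min (bernPMF (paramVecErase P z i k) u * bernPMF (fun _ => P k (z i)) v)
        (bernPMF (paramVecErase P z i l) u * bernPMF (fun _ => P l (z i)) v) := by
  unfold tvAffinity
  rw [sum_boolFun_split (Equiv.sumCompl fun j => j ≠ i).symm]
  refine Finset.sum_congr rfl fun u _ => Finset.sum_congr rfl fun v _ => ?_
  have : ∀ a, bernPMF (paramVec P z a) (fun j => Sum.elim u v ((Equiv.sumCompl fun j => j ≠ i).symm j))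
      = bernPMF (paramVecErase P z i a) u * bernPMF (fun _ => P a (z i)) v := by
    intro a
    rw [bernPMF_sumElim]
    congr 2
    funext ⟨b, hb⟩
    simp [paramVec, not_not.1 hb]
  rw [this, this]

theorem tvAffinity_paramVec_le :
    tvAffinity (bernPMF (paramVec P z k)) (bernPMF (paramVec P z l)) ≤
      tvAffinity (bernPMF (paramVecErase P z i k)) (bernPMF (paramVecErase P z i l)) := by
  rw [tvAffinity_paramVec P z i]
  refine Finset.sum_le_sum fun u _ => le_min ?_ ?_
  · refine (Finset.sum_le_sum fun v _ => min_le_left _ _).trans ?_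
    rw [← Finset.mul_sum, sum_bernPMF, mul_one]
  · refine (Finset.sum_le_sum fun v _ => min_le_right _ _).trans ?_
    rw [← Finset.mul_sum, sum_bernPMF, mul_one]

variable {P}

/-- Of the two outcomes at coordinate `i` only `false` is kept; both laws give it mass at least `ε`.
-/
theorem le_tvAffinity_paramVec (h01 : ∀ a b, 0 ≤ P a b ∧ P a b ≤ 1) {ε : ℝ}
    (hmax : maxEntry P ≤ 1 - ε) :
    ε * tvAffinity (bernPMF (paramVecErase P z i k)) (bernPMF (paramVecErase P z i l)) ≤
      tvAffinity (bernPMF (paramVec P z k)) (bernPMF (paramVec P z l)) := by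
  rw [tvAffinity_paramVec P z i]
  unfold tvAffinity
  rw [Finset.mul_sum]
  refine Finset.sum_le_sum fun u _ => ?_
  have hnn : ∀ a, 0 ≤ bernPMF (paramVecErase P z i a) u :=
    fun a => bernPMF_nonneg (fun j => h01 _ _) u
  have hε : ∀ a b, ε ≤ 1 - P a b := fun a b => by linarith [le_maxEntry P a b]
  have hv : ∀ r : ℝ, bernPMF (fun _ : {j : Fin n // ¬ j ≠ i} => r) (fun _ => false) = 1 - r := by
    intro r
    have : Subsingleton {j : Fin n // ¬ j ≠ i} :=
      ⟨fun a b => Subtype.ext ((not_not.1 a.2).trans (not_not.1 b.2).symm)⟩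
    unfold bernPMF
    rw [Fintype.prod_subsingleton _ ⟨i, not_not.2 rfl⟩]
    simp
  refine le_trans ?_ (Finset.single_le_sum (fun v _ => ?_) (Finset.mem_univ fun _ => false))
  · rw [hv, hv]
    refine le_min ?_ ?_
    · nlinarith [min_le_left (bernPMF (paramVecErase P z i k) u) (bernPMF (paramVecErase P z i l) u),
        le_min (hnn k) (hnn l), hε k (z i), h01 k (z i)]
    · nlinarith [min_le_right (bernPMF (paramVecErase P z i k) u) (bernPMF (paramVecErase P z i l) u),
        le_min (hnn k) (hnn l), hε l (z i), h01 l (z i)]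
  · exact le_min (mul_nonneg (hnn k) (bernPMF_nonneg (fun _ => h01 _ _) _))
      (mul_nonneg (hnn l) (bernPMF_nonneg (fun _ => h01 _ _) _))

end Bayes

/-! ### Local bounds for binomial weights -/

section Binomial

/-- Point masses of the binomial distribution. -/
def binomWeight (N : ℕ) (r : ℝ) (y : ℕ) : ℝ := N.choose y * r ^ y * (1 - r) ^ (N - y)

variable {N : ℕ} {r s T : ℝ}

theorem binomWeight_nonneg (hr0 : 0 < r) (hr1 : r < 1) (y : ℕ) : 0 ≤ binomWeight N r y := by
  have : 0 < 1 - r := by linarith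
  unfold binomWeight
  positivity

theorem sum_binomWeight (N : ℕ) (r : ℝ) : ∑ y ∈ range (N + 1), binomWeight N r y = 1 := by
  have := sum_bernPMF_const (ι := Fin N) r fun _ => 1
  simp only [mul_one, sum_bernPMF, Fintype.card_fin] at this
  exact this.symm

theorem sum_binomWeight_le_one (hr0 : 0 < r) (hr1 : r < 1) (S : Finset ℕ) :
    ∑ y ∈ S, binomWeight N r y ≤ 1 := by
  rw [← sum_binomWeight N r]
  rw [Finset.sum_subset (Finset.subset_union_right (s₁ := S) (s₂ := range (N + 1)))]
  · exact Finset.sum_le_sum_of_subset_of_nonneg Finset.subset_union_left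
      fun y _ _ => binomWeight_nonneg hr0 hr1 y
  · intro y _ hy
    rw [Finset.mem_range, not_lt] at hy
    simp [binomWeight, Nat.choose_eq_zero_of_lt (Nat.lt_of_succ_le hy)]

theorem binomWeight_succ (y : ℕ) :
    (y + 1) * (1 - r) * binomWeight N r (y + 1) = (N - y) * r * binomWeight N r y := by
  unfold binomWeight
  rcases lt_or_ge y N with h | h
  · have h1 := congrArg (Nat.cast (R := ℝ)) (Nat.choose_succ_right_eq N y)
    push_cast [Nat.cast_sub h.le] at h1
    obtain ⟨d, rfl⟩ := Nat.exists_eq_add_of_lt h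
    have e1 : y + d + 1 - (y + 1) = d := by omega
    have e2 : y + d + 1 - y = d + 1 := by omega
    rw [e1, e2, pow_succ, pow_succ]
    push_cast at h1 ⊢
    linear_combination r ^ y * r * (1 - r) ^ d * (1 - r) * h1
  · rw [Nat.choose_eq_zero_of_lt (Nat.lt_succ_of_le h)]
    rcases h.eq_or_lt with rfl | h
    · simp
    · simp [Nat.choose_eq_zero_of_lt h]

theorem exp_neg_two_mul_le {δ : ℝ} (h0 : 0 ≤ δ) (h1 : δ ≤ 1 / 2) : Real.exp (-(2 * δ)) ≤ 1 - δ := by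
  rw [Real.exp_neg]
  refine inv_le_of_inv_le₀ (by linarith) ((inv_le_of_inv_le₀ (by linarith) ?_).trans
    (Real.add_one_le_exp _))
  rw [inv_le_comm₀ (by linarith) (by linarith), inv_eq_one_div, div_le_iff₀ (by linarith)]
  nlinarith

/-- The ratio of consecutive weights is `(N - y) r / ((y + 1)(1 - r))`. Both terms are at least `s²
/ 2`, and their difference lies between the deviations of `y` and `y + 1` from the mean, hence is at
most `T s`. The ratio and its inverse are thus at least `1 - 2T/s`. -/
theorem binomWeight_step (hr0 : 0 < r) (hr1 : r < 1) (hs : 0 < s) (hV : s ^ 2 = N * r * (1 - r))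
    (hT : 0 ≤ T) (hTs : 4 * T ≤ s) {y : ℕ} (h1 : |(y : ℝ) - N * r| ≤ T * s)
    (h2 : |(y : ℝ) + 1 - N * r| ≤ T * s) :
    Real.exp (-(4 * T / s)) * binomWeight N r y ≤ binomWeight N r (y + 1) ∧
      Real.exp (-(4 * T / s)) * binomWeight N r (y + 1) ≤ binomWeight N r y := by
  have hrec := binomWeight_succ (N := N) (r := r) y
  have hb := binomWeight_nonneg (N := N) hr0 hr1 y
  have hb' := binomWeight_nonneg (N := N) hr0 hr1 (y + 1)
  rw [abs_le] at h1 h2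
  have hTs' : 0 ≤ T * s := by positivity
  have hTV : 4 * (T * s) ≤ s ^ 2 := by nlinarith
  have ha : s ^ 2 / 2 ≤ (y + 1) * (1 - r) := by nlinarith
  have hc : s ^ 2 / 2 ≤ (N - y) * r := by nlinarith
  have hac : (y + 1) * (1 - r) - (N - y) * r = y - N * r + (1 - r) := by ring
  have hs2 : 0 < s ^ 2 / 2 := by positivity
  have hδ : Real.exp (-(4 * T / s)) ≤ 1 - 2 * T / s := by
    have := exp_neg_two_mul_le (δ := 2 * T / s) (by positivity)
      (by rw [div_le_iff₀ hs]; linarith)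
    convert this using 2
    ring
  have hδs : 2 * T / s * (s ^ 2 / 2) = T * s := by field_simp
  have hδ0 : 0 ≤ 2 * T / s := by positivity
  generalize (y + 1) * (1 - r) = a at *
  generalize (N - y) * r = c at *
  have ha0 : 0 < a := by linarith
  have hc0 : 0 < c := by linarith
  have k1 : (1 - 2 * T / s) * a ≤ c := by nlinarith
  have k2 : (1 - 2 * T / s) * c ≤ a := by nlinarith
  constructor
  · refine (mul_le_mul_of_nonneg_right hδ hb).trans (le_of_mul_le_mul_left ?_ ha0)
    rw [hrec]
    nlinarith
  · refine (mul_le_mul_of_nonneg_right hδ hb').trans (le_of_mul_le_mul_left ?_ hc0)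
    rw [← hrec]
    nlinarith

theorem binomWeight_harnack_aux (hr0 : 0 < r) (hr1 : r < 1) (hs : 0 < s)
    (hV : s ^ 2 = N * r * (1 - r)) (hT : 0 ≤ T) (hTs : 4 * T ≤ s) {y : ℕ}
    (h1 : |(y : ℝ) - N * r| ≤ T * s) (d : ℕ) (h2 : |((y + d : ℕ) : ℝ) - N * r| ≤ T * s) :
    Real.exp (-(4 * T / s * d)) * binomWeight N r y ≤ binomWeight N r (y + d) ∧
      Real.exp (-(4 * T / s * d)) * binomWeight N r (y + d) ≤ binomWeight N r y := by
  induction d with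
  | zero => simp
  | succ d ih =>
    have h3 : |((y + d : ℕ) : ℝ) - N * r| ≤ T * s := by
      rw [abs_le] at h1 h2 ⊢
      push_cast at h2 ⊢
      constructor
      · linarith [h1.1, Nat.cast_nonneg (α := ℝ) d]
      · linarith [h2.2]
    obtain ⟨i1, i2⟩ := ih h3
    obtain ⟨j1, j2⟩ := binomWeight_step hr0 hr1 hs hV hT hTs h3
      (by push_cast at h2 ⊢; rwa [add_assoc])
    have e : Real.exp (-(4 * T / s * (d + 1 : ℕ))) =
        Real.exp (-(4 * T / s)) * Real.exp (-(4 * T / s * d)) := by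
      rw [← Real.exp_add]; congr 1; push_cast; ring
    rw [e]
    constructor
    · rw [mul_assoc]
      exact (mul_le_mul_of_nonneg_left i1 (Real.exp_nonneg _)).trans j1
    · rw [mul_comm (Real.exp _), mul_assoc]
      exact (mul_le_mul_of_nonneg_left j2 (Real.exp_nonneg _)).trans i2

/-- Binomial weights within `T` standard deviations of the mean are comparable. -/
theorem binomWeight_harnack (hr0 : 0 < r) (hr1 : r < 1) (hs : 0 < s)
    (hV : s ^ 2 = N * r * (1 - r)) (hT : 0 ≤ T) (hTs : 4 * T ≤ s) {y y' : ℕ}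
    (h1 : |(y : ℝ) - N * r| ≤ T * s) (h2 : |(y' : ℝ) - N * r| ≤ T * s) :
    Real.exp (-(8 * T ^ 2)) * binomWeight N r y ≤ binomWeight N r y' := by
  -- The window contains at most `2 T s` steps, each costing a factor `exp(-4T/s)`.
  have key : ∀ d : ℕ, (d : ℝ) ≤ 2 * (T * s) → Real.exp (-(8 * T ^ 2)) ≤
      Real.exp (-(4 * T / s * d)) := fun d hd => by
    rw [Real.exp_le_exp, neg_le_neg_iff]
    calc 4 * T / s * d ≤ 4 * T / s * (2 * (T * s)) := by gcongr
      _ = 8 * T ^ 2 := by field_simp; ring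
  rcases le_total y y' with h | h
  · obtain ⟨d, rfl⟩ := Nat.exists_eq_add_of_le h
    refine (mul_le_mul_of_nonneg_right (key d ?_) (binomWeight_nonneg hr0 hr1 _)).trans
      (binomWeight_harnack_aux hr0 hr1 hs hV hT hTs h1 d h2).1
    rw [abs_le] at h1 h2
    push_cast at h2
    linarith [h1.1, h2.2]
  · obtain ⟨d, rfl⟩ := Nat.exists_eq_add_of_le h
    refine (mul_le_mul_of_nonneg_right (key d ?_) (binomWeight_nonneg hr0 hr1 _)).trans
      (binomWeight_harnack_aux hr0 hr1 hs hV hT hTs h2 d h1).2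
    rw [abs_le] at h1 h2
    push_cast at h1
    linarith [h1.2, h2.1]

/-- Binomial weights are at most of the order of the inverse standard deviation. -/
theorem binomWeight_le (hr0 : 0 < r) (hr1 : r < 1) (hV : s ^ 2 = N * r * (1 - r))
    (hs : 4 ≤ s) (y : ℕ) : binomWeight N r y ≤ 2 * Real.exp 16 / s := by
  have hs0 : 0 < s := by linarith
  have hm : 0 ≤ N * r := by positivity
  set c : ℕ := ⌈N * r⌉₊ with hc
  have hc1 : N * r ≤ c := Nat.le_ceil _
  have hc2 : (c : ℝ) < N * r + 1 := Nat.ceil_lt_add_one hm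
  have hwin : |(c : ℝ) - N * r| ≤ 1 * s := by rw [abs_le]; constructor <;> linarith
  have hH : ∀ {y y' : ℕ}, |(y : ℝ) - N * r| ≤ 1 * s → |(y' : ℝ) - N * r| ≤ 1 * s →
      Real.exp (-8) * binomWeight N r y ≤ binomWeight N r y' := fun h h' => by
    simpa using binomWeight_harnack hr0 hr1 hs0 hV zero_le_one (by linarith) h h'
  -- The `⌊s⌋` weights starting at `c` are all at least `e⁻⁸` times the weight at `c`, and their sum
  -- is at most one.
  have hcle : binomWeight N r c ≤ 2 * Real.exp 8 / s := by
    have h1 : ∑ i ∈ range ⌊s⌋₊, Real.exp (-8) * binomWeight N r c ≤ 1 := by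
      refine le_trans (Finset.sum_le_sum fun i hi => ?_)
        ((Finset.sum_map (range ⌊s⌋₊) (addLeftEmbedding c) (binomWeight N r)).symm.le.trans
          (sum_binomWeight_le_one hr0 hr1 _))
      refine hH hwin ?_
      have : ((i + 1 : ℕ) : ℝ) ≤ s := (Nat.le_floor_iff hs0.le).1 (Finset.mem_range.1 hi)
      simp only [addLeftEmbedding_apply]
      push_cast at this ⊢
      rw [abs_le]
      constructor <;> linarith [Nat.cast_nonneg (α := ℝ) i]
    rw [Finset.sum_const, Finset.card_range, nsmul_eq_mul] at h1
    have h2 : s / 2 ≤ ⌊s⌋₊ := by linarith [Nat.lt_floor_add_one s]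
    rw [le_div_iff₀ hs0]
    have h3 : Real.exp 8 * Real.exp (-8) = 1 := by rw [← Real.exp_add]; simp
    have hb := binomWeight_nonneg (N := N) hr0 hr1 c
    have h4 : s / 2 * (Real.exp (-8) * binomWeight N r c) ≤ 1 :=
      (mul_le_mul_of_nonneg_right h2 (by positivity)).trans h1
    calc binomWeight N r c * s
        = 2 * (Real.exp 8 * Real.exp (-8)) * (s / 2 * binomWeight N r c) := by rw [h3]; ring
      _ = 2 * Real.exp 8 * (s / 2 * (Real.exp (-8) * binomWeight N r c)) := by ring
      _ ≤ 2 * Real.exp 8 * 1 := by gcongr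
      _ = 2 * Real.exp 8 := mul_one _
  have h16 : Real.exp 16 = Real.exp 8 * Real.exp 8 := by rw [← Real.exp_add]; norm_num
  have h8 : 1 ≤ Real.exp 8 := Real.one_le_exp (by norm_num)
  have hcle' : binomWeight N r c ≤ 2 * Real.exp 16 / s := by
    refine hcle.trans ?_
    rw [h16]
    gcongr
    nlinarith
  rcases le_or_gt c y with h | h
  · refine le_trans ?_ hcle'
    induction y, h using Nat.le_induction with
    | base => exact le_rfl
    | succ y hy ih =>
      refine le_trans ?_ ih
      have hrec := binomWeight_succ (N := N) (r := r) y
      have hcy : (c : ℝ) ≤ y := by exact_mod_cast hy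
      have hb' := binomWeight_nonneg (N := N) hr0 hr1 y
      have hpos : 0 < (y + 1) * (1 - r) := by
        have : 0 < 1 - r := by linarith
        positivity
      refine le_of_mul_le_mul_left ?_ hpos
      rw [hrec]
      nlinarith
  -- Weights decrease from `c` on and increase up to `d = c - 1`. Passing from `c` to `d` costs one
  -- more factor `e⁸`, whence `e¹⁶`.
  · obtain ⟨d, hd⟩ : ∃ d, c = d + 1 := Nat.exists_eq_add_one.2 (by omega)
    have hd' : (c : ℝ) = d + 1 := by exact_mod_cast hd
    have hdle : binomWeight N r d ≤ 2 * Real.exp 16 / s := by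
      have h1 := hH (y := d) (y' := c) (by rw [abs_le]; constructor <;> linarith) hwin
      have h3 : Real.exp 8 * Real.exp (-8) = 1 := by rw [← Real.exp_add]; simp
      calc binomWeight N r d = Real.exp 8 * (Real.exp (-8) * binomWeight N r d) := by
            rw [← mul_assoc, h3, one_mul]
        _ ≤ Real.exp 8 * (2 * Real.exp 8 / s) := by gcongr; exact h1.trans hcle
        _ = 2 * Real.exp 16 / s := by rw [h16]; ring
    have hyd : y ≤ d := by omega
    refine le_trans ?_ hdle
    have hmono : MonotoneOn (binomWeight N r) (Set.Iic d) := by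
      refine monotoneOn_of_le_succ Set.ordConnected_Iic fun x _ _ hx => ?_
      rw [Nat.succ_eq_succ, Set.mem_Iic] at hx
      rw [Nat.succ_eq_succ]
      have hx' : (x : ℝ) + 1 ≤ d := by exact_mod_cast hx
      have hrec := binomWeight_succ (N := N) (r := r) x
      have hb' := binomWeight_nonneg (N := N) hr0 hr1 (x + 1)
      have hle : (x + 1) * (1 - r) ≤ (N - x) * r := by nlinarith
      have hpos : 0 < (x + 1) * (1 - r) := by
        have : 0 < 1 - r := by linarith
        positivity
      refine le_of_mul_le_mul_left ?_ (hpos.trans_le hle)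
      rw [← hrec]
      exact mul_le_mul_of_nonneg_right hle hb'
    exact hmono hyd (le_refl d) hyd

/-- Half of the binomial mass lies within two standard deviations of the mean. -/
theorem half_le_sum_binomWeight (hr0 : 0 < r) (hr1 : r < 1) (hs : 0 < s)
    (hV : s ^ 2 = N * r * (1 - r)) :
    1 / 2 ≤ ∑ y ∈ (range (N + 1)).filter (fun y : ℕ => |(y : ℝ) - N * r| ≤ 2 * s),
      binomWeight N r y := by
  have h := bernPMF_chebyshev (ι := Fin N) (p := fun _ => r) (fun _ => ⟨hr0.le, hr1.le⟩)
    (fun _ => 1) (T := 2 * s) (by positivity) (by simp; nlinarith)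
  rw [Finset.sum_filter] at h ⊢
  refine h.trans (le_of_eq ?_)
  have h2 := sum_bernPMF_const (ι := Fin N) r fun y => if |(y : ℝ) - N * r| ≤ 2 * s then 1 else 0
  rw [Fintype.card_fin] at h2
  simp only [mul_ite, mul_one, mul_zero] at h2
  unfold binomWeight
  rw [← h2]
  refine Finset.sum_congr rfl fun x _ => ?_
  congr 3
  simp [Finset.sum_sub_distrib]

/-- In the bulk, binomial weights are at least of the order of the inverse standard deviation. -/
theorem le_binomWeight (hr0 : 0 < r) (hr1 : r < 1) (hV : s ^ 2 = N * r * (1 - r)) (hT : 2 ≤ T)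
    (hTs : 4 * T ≤ s) {y : ℕ} (hy : |(y : ℝ) - N * r| ≤ T * s) :
    Real.exp (-(8 * T ^ 2)) / (10 * s) ≤ binomWeight N r y := by
  have hs0 : 0 < s := by linarith
  have hm : 0 ≤ N * r := by positivity
  have h := half_le_sum_binomWeight hr0 hr1 hs0 hV
  have hE : Real.exp (8 * T ^ 2) * Real.exp (-(8 * T ^ 2)) = 1 := by rw [← Real.exp_add]; simp
  have hle : ∀ y' ∈ (range (N + 1)).filter (fun y' : ℕ => |(y' : ℝ) - N * r| ≤ 2 * s),
      binomWeight N r y' ≤ Real.exp (8 * T ^ 2) * binomWeight N r y := by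
    intro y' hy'
    have := binomWeight_harnack hr0 hr1 hs0 hV (by linarith) hTs
      ((Finset.mem_filter.1 hy').2.trans (mul_le_mul_of_nonneg_right hT hs0.le)) hy
    calc binomWeight N r y' = Real.exp (8 * T ^ 2) *
          (Real.exp (-(8 * T ^ 2)) * binomWeight N r y') := by rw [← mul_assoc, hE, one_mul]
      _ ≤ _ := by gcongr
  -- An interval of length `4 s` has at most `4 s + 1` integers, and `s ≥ 1`.
  have hcard : (#((range (N + 1)).filter (fun y' : ℕ => |(y' : ℝ) - N * r| ≤ 2 * s)) : ℝ) ≤ 5 * s := by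
    have hsub : (range (N + 1)).filter (fun y' : ℕ => |(y' : ℝ) - N * r| ≤ 2 * s) ⊆
        Finset.Icc ⌈N * r - 2 * s⌉₊ ⌊N * r + 2 * s⌋₊ := by
      intro y' hy'
      have := abs_le.1 (Finset.mem_filter.1 hy').2
      rw [Finset.mem_Icc, Nat.ceil_le, Nat.le_floor_iff (by positivity)]
      constructor <;> linarith
    have h1 := Finset.card_le_card hsub
    rw [Nat.card_Icc] at h1
    have h2 := Nat.le_ceil (N * r - 2 * s)
    have h3 := Nat.floor_le (show 0 ≤ N * r + 2 * s by positivity)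
    rcases le_total ⌈N * r - 2 * s⌉₊ (⌊N * r + 2 * s⌋₊ + 1) with h4 | h4
    · have h5 := (Nat.cast_le (α := ℝ)).2 h1
      rw [Nat.cast_sub h4] at h5
      push_cast at h5
      linarith
    · rw [Nat.sub_eq_zero_of_le h4, Nat.le_zero] at h1
      rw [h1]
      push_cast
      positivity
  have h6 := h.trans (Finset.sum_le_card_nsmul _ _ _ hle)
  rw [nsmul_eq_mul] at h6
  have hb := binomWeight_nonneg (N := N) hr0 hr1 y
  have h7 : 1 / 2 ≤ 5 * s * (Real.exp (8 * T ^ 2) * binomWeight N r y) :=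
    h6.trans (mul_le_mul_of_nonneg_right hcard (by positivity))
  rw [div_le_iff₀ (by positivity)]
  calc Real.exp (-(8 * T ^ 2)) = Real.exp (-(8 * T ^ 2)) * 2 * (1 / 2) := by ring
    _ ≤ Real.exp (-(8 * T ^ 2)) * 2 * (5 * s * (Real.exp (8 * T ^ 2) * binomWeight N r y)) := by
        gcongr
    _ = Real.exp (8 * T ^ 2) * Real.exp (-(8 * T ^ 2)) * (binomWeight N r y * (10 * s)) := by ring
    _ = _ := by rw [hE, one_mul]

end Binomial

/-! ### Exponential moments of linear statistics with a dominant block of equal coordinates -/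

section Laplace

theorem sum_le_of_le_geometric {S : Finset ℕ} {g : ℕ → ℝ} {f : ℕ → ℕ} {ρ : ℝ} (h0 : 0 ≤ ρ)
    (h1 : ρ < 1) (hf : Set.InjOn f S) (hg : ∀ y ∈ S, g y ≤ ρ ^ f y) :
    ∑ y ∈ S, g y ≤ (1 - ρ)⁻¹ := by
  refine (Finset.sum_le_sum hg).trans ?_
  rw [← Finset.sum_image (f := fun k => ρ ^ k) (g := f) hf]
  exact sum_le_hasSum _ (fun k _ => pow_nonneg h0 k) (hasSum_geometric_of_lt_one h0 h1)

/-- Each side of `⌈c⌉` is dominated by a geometric series of ratio `e^{-a}`, and `1 - e^{-a} ≥ a /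
(1 + a)`. -/
theorem sum_exp_neg_mul_abs_sub_le {a : ℝ} (ha : 0 < a) (c : ℝ) (S : Finset ℕ) :
    ∑ y ∈ S, Real.exp (-(a * |(y : ℝ) - c|)) ≤ 2 * ((1 + a) / a) := by
  have hρ1 : Real.exp (-a) < 1 := by
    rw [Real.exp_lt_one_iff]
    linarith
  have hinv : (1 - Real.exp (-a))⁻¹ ≤ (1 + a) / a := by
    refine inv_le_of_inv_le₀ (by positivity) ?_
    rw [inv_div, Real.exp_neg]
    have h1 : (Real.exp a)⁻¹ ≤ (1 + a)⁻¹ := by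
      gcongr
      linarith [Real.add_one_le_exp a]
    have h2 : a / (1 + a) = 1 - (1 + a)⁻¹ := by field_simp; ring
    linarith
  have hc1 := Int.le_ceil c
  have hc2 := Int.ceil_lt_add_one c
  have hpow : ∀ k : ℕ, Real.exp (-a) ^ k = Real.exp (-(a * k)) := fun k => by
    rw [← Real.exp_nat_mul]; congr 1; ring
  rw [← Finset.sum_filter_add_sum_filter_not S fun y : ℕ => ⌈c⌉ ≤ (y : ℤ)]
  have hA : ∑ y ∈ S.filter (fun y : ℕ => ⌈c⌉ ≤ (y : ℤ)), Real.exp (-(a * |(y : ℝ) - c|)) ≤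
      (1 - Real.exp (-a))⁻¹ := by
    refine sum_le_of_le_geometric (f := fun y => ((y : ℤ) - ⌈c⌉).toNat) (Real.exp_nonneg _) hρ1
      ?_ ?_
    · intro x hx y hy hxy
      have hx' := (Finset.mem_filter.1 hx).2
      have hy' := (Finset.mem_filter.1 hy).2
      simp only at hxy
      omega
    · intro y hy
      have hy' := (Finset.mem_filter.1 hy).2
      have e : ((((y : ℤ) - ⌈c⌉).toNat : ℕ) : ℝ) = y - ⌈c⌉ := by
        have : ((((y : ℤ) - ⌈c⌉).toNat : ℕ) : ℤ) = y - ⌈c⌉ := Int.toNat_of_nonneg (by omega)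
        exact_mod_cast congrArg (Int.cast (R := ℝ)) this
      rw [hpow, e, Real.exp_le_exp, neg_le_neg_iff]
      gcongr
      exact le_trans (by linarith) (le_abs_self _)
  have hB : ∑ y ∈ S.filter (fun y : ℕ => ¬ ⌈c⌉ ≤ (y : ℤ)), Real.exp (-(a * |(y : ℝ) - c|)) ≤
      (1 - Real.exp (-a))⁻¹ := by
    refine sum_le_of_le_geometric (f := fun y => (⌈c⌉ - 1 - (y : ℤ)).toNat) (Real.exp_nonneg _) hρ1
      ?_ ?_
    · intro x hx y hy hxy
      have hx' := (Finset.mem_filter.1 hx).2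
      have hy' := (Finset.mem_filter.1 hy).2
      simp only at hxy
      omega
    · intro y hy
      have hy' := (Finset.mem_filter.1 hy).2
      have e : (((⌈c⌉ - 1 - (y : ℤ)).toNat : ℕ) : ℝ) = ⌈c⌉ - 1 - y := by
        have : (((⌈c⌉ - 1 - (y : ℤ)).toNat : ℕ) : ℤ) = ⌈c⌉ - 1 - y :=
          Int.toNat_of_nonneg (by omega)
        exact_mod_cast congrArg (Int.cast (R := ℝ)) this
      rw [hpow, e, Real.exp_le_exp, neg_le_neg_iff]
      gcongr
      exact le_trans (by linarith) (neg_le_abs _)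
  linarith

variable {N : ℕ} {r s : ℝ}

theorem abs_affine_eq {lam : ℝ} (hlam : lam ≠ 0) (m t y : ℝ) :
    |lam * (y - m) + t| = |lam| * |y - (m - t / lam)| := by
  rw [← abs_mul]
  congr 1
  field_simp
  ring

/-- The bound is uniform in the shift `t`, so it survives averaging over the coordinates outside the
block. -/
theorem sum_binomWeight_mul_exp_le (hr0 : 0 < r) (hr1 : r < 1) (hV : s ^ 2 = N * r * (1 - r))
    (hs : 4 ≤ s) {κ lam : ℝ} (hκ : 0 < κ) (hlam : lam ≠ 0) (t : ℝ) :
    ∑ y ∈ range (N + 1), binomWeight N r y * Real.exp (-(κ * |lam * (y - N * r) + t|)) ≤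
      2 * Real.exp 16 / s * (2 * ((1 + κ * |lam|) / (κ * |lam|))) := by
  have hs0 : 0 < s := by linarith
  calc _ ≤ ∑ y ∈ range (N + 1), 2 * Real.exp 16 / s *
        Real.exp (-(κ * |lam| * |(y : ℝ) - (N * r - t / lam)|)) := by
        refine Finset.sum_le_sum fun y _ => ?_
        rw [abs_affine_eq hlam, ← mul_assoc κ]
        exact mul_le_mul_of_nonneg_right (binomWeight_le hr0 hr1 hV hs y) (Real.exp_nonneg _)
    _ ≤ _ := by
        rw [← Finset.mul_sum]
        exact mul_le_mul_of_nonneg_left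
          (sum_exp_neg_mul_abs_sub_le (mul_pos hκ (abs_pos.2 hlam)) _ _) (by positivity)

/-- The affine form vanishes at a point `c` within `τ s` of the mean. The `⌈1/|λ|⌉` integers from
`⌈c⌉` on stay within `(τ + 2) s`, because rounding and `1/|λ|` each add at most `s`; on them the
exponent is at most `|λ| + 1`. -/
theorem le_sum_binomWeight_mul_exp (hr0 : 0 < r) (hr1 : r < 1) (hV : s ^ 2 = N * r * (1 - r))
    {lam τ t M : ℝ} (hτ : 0 ≤ τ) (hs : 4 * (τ + 2) ≤ s) (hlam : 1 ≤ |lam| * s) (hM : |lam| ≤ M)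
    (ht : |t| ≤ |lam| * (τ * s)) :
    Real.exp (-(8 * (τ + 2) ^ 2)) / (10 * s) * Real.exp (-(M + 1)) / |lam| ≤
      ∑ y ∈ range (N + 1), binomWeight N r y * Real.exp (-|lam * (y - N * r) + t|) := by
  have hs0 : 0 < s := by linarith
  have hl0 : 0 < |lam| := by
    by_contra h
    nlinarith
  have hlne : lam ≠ 0 := abs_pos.1 hl0
  set c : ℝ := N * r - t / lam with hc
  have htc : |t / lam| ≤ τ * s := by
    rw [abs_div, div_le_iff₀ hl0, mul_comm _ |lam|]
    exact ht
  have hinv : 1 / |lam| ≤ s := by rw [div_le_iff₀ hl0, mul_comm]; exact hlam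
  rw [abs_le] at htc
  have hmean : s ^ 2 ≤ N * r := by
    rw [hV]
    have : 0 ≤ N * r := by positivity
    nlinarith
  have hc0 : 0 ≤ c := by nlinarith
  have hc1 := Nat.le_ceil c
  have hc2 := Nat.ceil_lt_add_one hc0
  have key : ∀ i ∈ range ⌈1 / |lam|⌉₊,
      Real.exp (-(8 * (τ + 2) ^ 2)) / (10 * s) ≤ binomWeight N r (⌈c⌉₊ + i) ∧
        Real.exp (-(M + 1)) ≤ Real.exp (-|lam * ((⌈c⌉₊ + i : ℕ) - N * r) + t|) := by
    intro i hi
    have hi' : (i : ℝ) < 1 / |lam| := Nat.lt_ceil.1 (Finset.mem_range.1 hi)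
    have hi0 : (0 : ℝ) ≤ i := Nat.cast_nonneg i
    constructor
    · refine le_binomWeight hr0 hr1 hV (by linarith) hs ?_
      push_cast
      rw [abs_le]
      constructor <;> linarith
    · rw [Real.exp_le_exp, neg_le_neg_iff, abs_affine_eq hlne, ← hc]
      push_cast
      have h1 : |(⌈c⌉₊ : ℝ) + i - c| ≤ 1 + 1 / |lam| := by
        rw [abs_le]
        have : 0 < 1 / |lam| := by positivity
        constructor <;> linarith
      calc |lam| * |(⌈c⌉₊ : ℝ) + i - c| ≤ |lam| * (1 + 1 / |lam|) := by gcongr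
        _ = |lam| + 1 := by field_simp
        _ ≤ M + 1 := by linarith
  -- These integers cannot exceed `N`, where the weight would vanish.
  have hsub : (range ⌈1 / |lam|⌉₊).map (addLeftEmbedding ⌈c⌉₊) ⊆ range (N + 1) := by
    intro y hy
    obtain ⟨i, hi, rfl⟩ := Finset.mem_map.1 hy
    rw [Finset.mem_range, addLeftEmbedding_apply]
    by_contra hcon
    have h1 := (key i hi).1
    have h2 : binomWeight N r (⌈c⌉₊ + i) = 0 := by
      simp [binomWeight, Nat.choose_eq_zero_of_lt (show N < ⌈c⌉₊ + i by omega)]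
    rw [h2] at h1
    have : 0 < Real.exp (-(8 * (τ + 2) ^ 2)) / (10 * s) := by positivity
    linarith
  refine le_trans ?_ (Finset.sum_le_sum_of_subset_of_nonneg hsub fun y _ _ =>
    mul_nonneg (binomWeight_nonneg hr0 hr1 y) (Real.exp_nonneg _))
  rw [Finset.sum_map]
  calc _ ≤ (⌈1 / |lam|⌉₊ : ℝ) *
        (Real.exp (-(8 * (τ + 2) ^ 2)) / (10 * s) * Real.exp (-(M + 1))) := by
        rw [div_eq_inv_mul _ |lam|, ← one_div]
        gcongr
        exact Nat.le_ceil _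
    _ = ∑ i ∈ range ⌈1 / |lam|⌉₊,
        Real.exp (-(8 * (τ + 2) ^ 2)) / (10 * s) * Real.exp (-(M + 1)) := by
        rw [Finset.sum_const, Finset.card_range, nsmul_eq_mul]
    _ ≤ _ := by
        refine Finset.sum_le_sum fun i hi => ?_
        obtain ⟨h1, h2⟩ := key i hi
        exact mul_le_mul h1 h2 (Real.exp_nonneg _) (binomWeight_nonneg hr0 hr1 _)

variable {ι : Type*} [Fintype ι] [DecidableEq ι] {p c : ι → ℝ} {A : ι → Prop} [DecidablePred A]
  {lam : ℝ}

/-- The centred linear statistic `∑ⱼ cⱼ (xⱼ - pⱼ)`. -/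
def centredSum {ι : Type*} [Fintype ι] (p c : ι → ℝ) (x : ι → Bool) : ℝ :=
  ∑ j, c j * ((if x j then 1 else 0) - p j)

theorem sum_bernPMF_centredSum (hp : ∀ j, A j → p j = r) (hc : ∀ j, A j → c j = lam)
    (F : ℝ → ℝ) :
    ∑ x, bernPMF p x * F (centredSum p c x) =
      ∑ v : {j // ¬ A j} → Bool, bernPMF (fun j : {j // ¬ A j} => p j) v *
        ∑ y ∈ range (Fintype.card {j // A j} + 1), binomWeight (Fintype.card {j // A j}) r y *
          F (lam * (y - Fintype.card {j // A j} * r) +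
            centredSum (fun j : {j // ¬ A j} => p j) (fun j => c j) v) := by
  rw [sum_bernPMF_split (Equiv.sumCompl A).symm]
  refine Finset.sum_congr rfl fun v _ => congrArg₂ _ rfl ?_
  unfold binomWeight
  rw [← sum_bernPMF_const (ι := {j // A j}) r fun y =>
    F (lam * (y - Fintype.card {j // A j} * r) +
      centredSum (fun j : {j // ¬ A j} => p j) (fun j => c j) v)]
  refine Finset.sum_congr rfl fun u _ => ?_
  congr 2
  · funext j
    exact hp _ j.2
  · unfold centredSum
    rw [← Equiv.sum_comp (Equiv.sumCompl A), Fintype.sum_sum_type]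
    simp only [Equiv.symm_apply_apply, Sum.elim_inl, Sum.elim_inr]
    simp only [Equiv.sumCompl_apply_inl, Equiv.sumCompl_apply_inr]
    congr 1
    rw [Finset.sum_congr rfl fun (j : {j // A j}) _ => by rw [hp _ j.2, hc _ j.2],
      ← Finset.mul_sum, Finset.sum_sub_distrib]
    simp

theorem sum_bernPMF_exp_le (hp01 : ∀ j, 0 ≤ p j ∧ p j ≤ 1) (hr0 : 0 < r) (hr1 : r < 1)
    (hp : ∀ j, A j → p j = r) (hc : ∀ j, A j → c j = lam)
    (hV : s ^ 2 = Fintype.card {j // A j} * r * (1 - r)) (hs : 4 ≤ s) {κ : ℝ} (hκ : 0 < κ)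
    (hlam : lam ≠ 0) :
    ∑ x, bernPMF p x * Real.exp (-(κ * |centredSum p c x|)) ≤
      2 * Real.exp 16 / s * (2 * ((1 + κ * |lam|) / (κ * |lam|))) := by
  rw [sum_bernPMF_centredSum hp hc fun t => Real.exp (-(κ * |t|))]
  refine (Finset.sum_le_sum fun v _ => mul_le_mul_of_nonneg_left
    (sum_binomWeight_mul_exp_le hr0 hr1 hV hs hκ hlam _) (bernPMF_nonneg (fun j => hp01 _) v)).trans
    ?_
  rw [← Finset.sum_mul, sum_bernPMF, one_mul]

/-- By Chebyshev, with probability at least one half the coordinates outside the block shift the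
statistic by at most `|λ| τ s`, which is what the binomial lower bound tolerates. -/
theorem le_sum_bernPMF_exp (hp01 : ∀ j, 0 ≤ p j ∧ p j ≤ 1) (hr0 : 0 < r) (hr1 : r < 1)
    (hp : ∀ j, A j → p j = r) (hc : ∀ j, A j → c j = lam)
    (hV : s ^ 2 = Fintype.card {j // A j} * r * (1 - r)) {τ M : ℝ} (hτ : 0 < τ)
    (hs : 4 * (τ + 2) ≤ s) (hlam : 1 ≤ |lam| * s) (hM : |lam| ≤ M)
    (hvar : 2 * ∑ j, c j ^ 2 * (p j * (1 - p j)) ≤ (|lam| * (τ * s)) ^ 2) :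
    1 / 2 * (Real.exp (-(8 * (τ + 2) ^ 2)) / (10 * s) * Real.exp (-(M + 1)) / |lam|) ≤
      ∑ x, bernPMF p x * Real.exp (-|centredSum p c x|) := by
  have hs0 : 0 < s := by linarith
  have hl0 : 0 < |lam| := by
    by_contra h
    nlinarith
  rw [sum_bernPMF_centredSum hp hc fun t => Real.exp (-|t|)]
  have hvar' : 2 * ∑ j : {j // ¬ A j}, c j ^ 2 * (p j * (1 - p j)) ≤ (|lam| * (τ * s)) ^ 2 := by
    refine le_trans ?_ hvar
    rw [← Fintype.sum_subtype_add_sum_subtype A fun j => c j ^ 2 * (p j * (1 - p j))]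
    have : 0 ≤ ∑ j : {j // A j}, c j ^ 2 * (p j * (1 - p j)) := Finset.sum_nonneg fun j _ =>
      mul_nonneg (sq_nonneg _) (mul_nonneg (hp01 j).1 (sub_nonneg.2 (hp01 j).2))
    linarith
  have hcheb := bernPMF_chebyshev (p := fun j : {j // ¬ A j} => p j) (fun j => hp01 j)
    (fun j => c j) (T := |lam| * (τ * s)) (by positivity) hvar'
  refine (mul_le_mul_of_nonneg_right hcheb (by positivity)).trans ?_
  rw [Finset.sum_mul]
  refine (Finset.sum_le_sum fun v hv => mul_le_mul_of_nonneg_left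
    (le_sum_binomWeight_mul_exp hr0 hr1 hV hτ.le hs hlam hM (Finset.mem_filter.1 hv).2)
    (bernPMF_nonneg (fun j => hp01 _) v)).trans ?_
  refine Finset.sum_le_sum_of_subset_of_nonneg (Finset.filter_subset _ _) fun v _ _ =>
    mul_nonneg (bernPMF_nonneg (fun j => hp01 _) v) (Finset.sum_nonneg fun y _ =>
      mul_nonneg (binomWeight_nonneg hr0 hr1 y) (Real.exp_nonneg _))

end Laplace

/-! ### Exponential tilting between two product Bernoulli laws -/

section Tilting

/-- Increment of the log-likelihood ratio of `Bern q` to `Bern p` from `0` to `1`. -/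
def llrSlope (p q : ℝ) : ℝ := Real.log (q * (1 - p) / (p * (1 - q)))

/-- Log-likelihood ratio of `Bern q` to `Bern p` at `0`. -/
def llrZero (p q : ℝ) : ℝ := Real.log ((1 - q) / (1 - p))

/-- Logarithm of the Chernoff `a`-coefficient of `Bern p` and `Bern q`. -/
def logCoeff (p q a : ℝ) : ℝ :=
  a * llrZero p q + Real.log (1 - p + p * Real.exp (a * llrSlope p q))

/-- Parameter of the normalized geometric mean of `Bern p` and `Bern q`. -/
def tilt (p q a : ℝ) : ℝ :=
  p * Real.exp (a * llrSlope p q) / (1 - p + p * Real.exp (a * llrSlope p q))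

section Scalar

variable {p q : ℝ} (hp0 : 0 < p) (hp1 : p < 1) (hq0 : 0 < q) (hq1 : q < 1) (a : ℝ)
include hp0 hp1

theorem tilt_denom_pos : 0 < 1 - p + p * Real.exp (a * llrSlope p q) := by
  have : 0 < 1 - p := by linarith
  positivity

omit hp0 hp1 in
theorem logCoeff_zero : logCoeff p q 0 = 0 := by simp [logCoeff]

theorem one_sub_tilt : 1 - tilt p q a = (1 - p) / (1 - p + p * Real.exp (a * llrSlope p q)) := by
  have := (tilt_denom_pos (q := q) hp0 hp1 a).ne'
  unfold tilt
  field_simp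
  ring

theorem hasDerivAt_logCoeff :
    HasDerivAt (logCoeff p q) (llrZero p q + llrSlope p q * tilt p q a) a := by
  have h1 : HasDerivAt (fun a => 1 - p + p * Real.exp (a * llrSlope p q))
      (p * (Real.exp (a * llrSlope p q) * (1 * llrSlope p q))) a :=
    ((((hasDerivAt_id a).mul_const (llrSlope p q)).exp).const_mul p).const_add (1 - p)
  have h2 := ((hasDerivAt_id a).mul_const (llrZero p q)).add
    (h1.log (tilt_denom_pos hp0 hp1 a).ne')
  refine h2.congr_deriv ?_
  unfold tilt
  ring

theorem hasDerivAt_tilt :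
    HasDerivAt (tilt p q) (llrSlope p q * (tilt p q a * (1 - tilt p q a))) a := by
  have hd := tilt_denom_pos (q := q) hp0 hp1 a
  have h0 : HasDerivAt (fun a => p * Real.exp (a * llrSlope p q))
      (p * (Real.exp (a * llrSlope p q) * (1 * llrSlope p q))) a :=
    (((hasDerivAt_id a).mul_const (llrSlope p q)).exp).const_mul p
  have h1 := h0.const_add (1 - p)
  have h2 := h0.div h1 hd.ne'
  refine h2.congr_deriv ?_
  rw [one_sub_tilt hp0 hp1]
  unfold tilt
  field_simp
  ring

theorem tilt_mul_exp_logCoeff : tilt p q a * Real.exp (logCoeff p q a) =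
    p * Real.exp (a * (llrZero p q + llrSlope p q)) := by
  have hd := tilt_denom_pos (q := q) hp0 hp1 a
  unfold logCoeff tilt
  rw [Real.exp_add, Real.exp_log hd, mul_add a, Real.exp_add]
  field_simp

theorem one_sub_tilt_mul_exp_logCoeff : (1 - tilt p q a) * Real.exp (logCoeff p q a) =
    (1 - p) * Real.exp (a * llrZero p q) := by
  have hd := tilt_denom_pos (q := q) hp0 hp1 a
  rw [one_sub_tilt hp0 hp1]
  unfold logCoeff
  rw [Real.exp_add, Real.exp_log hd]
  field_simp

include hq0 hq1

theorem exp_llrSlope : Real.exp (llrSlope p q) = q * (1 - p) / (p * (1 - q)) := by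
  have : 0 < 1 - p := by linarith
  have : 0 < 1 - q := by linarith
  exact Real.exp_log (by positivity)

omit hp0 hq0 in
theorem exp_llrZero : Real.exp (llrZero p q) = (1 - q) / (1 - p) := by
  have : 0 < 1 - p := by linarith
  have : 0 < 1 - q := by linarith
  exact Real.exp_log (by positivity)

theorem logCoeff_one : logCoeff p q 1 = 0 := by
  have hp : 0 < 1 - p := by linarith
  have hq : 0 < 1 - q := by linarith
  unfold logCoeff llrZero
  rw [one_mul, one_mul, exp_llrSlope hp0 hp1 hq0 hq1, ← Real.log_mul (by positivity)
    (by positivity)]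
  convert Real.log_one
  field_simp
  ring

theorem exp_slope_bounds {a : ℝ} (ha0 : 0 ≤ a) (ha1 : a ≤ 1) :
    min 1 (q * (1 - p) / (p * (1 - q))) ≤ Real.exp (a * llrSlope p q) ∧
      Real.exp (a * llrSlope p q) ≤ max 1 (q * (1 - p) / (p * (1 - q))) := by
  rw [← exp_llrSlope hp0 hp1 hq0 hq1, min_le_iff, le_max_iff, Real.one_le_exp_iff,
    Real.exp_le_one_iff, Real.exp_le_exp, Real.exp_le_exp]
  rcases le_total 0 (llrSlope p q) with h | h
  · exact ⟨Or.inl (by positivity), Or.inr (by nlinarith)⟩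
  · exact ⟨Or.inr (by nlinarith), Or.inl (by nlinarith)⟩

/-- The odds of the tilted parameter are the weighted geometric mean of the odds of `p` and `q`. -/
theorem tilt_le {a b : ℝ} (ha0 : 0 ≤ a) (ha1 : a ≤ 1) (hpb : p ≤ b) (hqb : q ≤ b) (hb : b < 1) :
    tilt p q a ≤ b := by
  have hp : 0 < 1 - p := by linarith
  have hq : 0 < 1 - q := by linarith
  have hb1 : 0 < 1 - b := by linarith
  have hd := tilt_denom_pos (q := q) hp0 hp1 a
  have ht := (exp_slope_bounds hp0 hp1 hq0 hq1 ha0 ha1).2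
  unfold tilt
  rw [div_le_iff₀ hd]
  generalize Real.exp (a * llrSlope p q) = t at *
  suffices p * (1 - b) * t ≤ b * (1 - p) by linarith
  rcases le_max_iff.1 ht with h | h
  · nlinarith [mul_le_mul_of_nonneg_left h (mul_pos hp0 hb1).le]
  · refine (mul_le_mul_of_nonneg_left h (mul_pos hp0 hb1).le).trans ?_
    have : p * (1 - b) * (q * (1 - p) / (p * (1 - q))) = (1 - p) * ((1 - b) * q / (1 - q)) := by
      field_simp
    rw [this, mul_comm b]
    refine mul_le_mul_of_nonneg_left ?_ hp.le
    rw [div_le_iff₀ hq]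
    nlinarith

theorem le_tilt {a b : ℝ} (ha0 : 0 ≤ a) (ha1 : a ≤ 1) (hbp : b ≤ p) (hbq : b ≤ q) :
    b ≤ tilt p q a := by
  have hp : 0 < 1 - p := by linarith
  have hq : 0 < 1 - q := by linarith
  have hb1 : 0 < 1 - b := by linarith
  have hd := tilt_denom_pos (q := q) hp0 hp1 a
  have ht := (exp_slope_bounds hp0 hp1 hq0 hq1 ha0 ha1).1
  unfold tilt
  rw [le_div_iff₀ hd]
  generalize Real.exp (a * llrSlope p q) = t at *
  suffices b * (1 - p) ≤ p * (1 - b) * t by linarith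
  rcases min_le_iff.1 ht with h | h
  · nlinarith [mul_le_mul_of_nonneg_left h (mul_pos hp0 hb1).le]
  · refine le_trans ?_ (mul_le_mul_of_nonneg_left h (mul_pos hp0 hb1).le)
    have : p * (1 - b) * (q * (1 - p) / (p * (1 - q))) = (1 - p) * ((1 - b) * q / (1 - q)) := by
      field_simp
    rw [this, mul_comm b]
    refine mul_le_mul_of_nonneg_left ?_ hp.le
    rw [le_div_iff₀ hq]
    nlinarith

end Scalar

/-- Second-order Taylor lower bound at a critical point. -/
theorem add_sq_le_of_deriv2_ge {f f' g : ℝ → ℝ} {m a : ℝ} (hf : ∀ x, HasDerivAt f (f' x) x)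
    (hf' : ∀ x, HasDerivAt f' (g x) x) (hg : ∀ x ∈ Set.Icc (0 : ℝ) 1, m ≤ g x)
    (ha : a ∈ Set.Icc (0 : ℝ) 1) (hcrit : f' a = 0) {x : ℝ} (hx : x ∈ Set.Icc (0 : ℝ) 1) :
    f a + m / 2 * (x - a) ^ 2 ≤ f x := by
  -- After subtracting the parabola the derivative is nondecreasing on `[0, 1]` and vanishes at `a`,
  -- so `a` is a minimum.
  have hh : ∀ x, HasDerivAt (fun x => f x - m / 2 * (x - a) ^ 2) (f' x - m * (x - a)) x := by
    intro x
    have h1 := (hf x).sub ((((hasDerivAt_id x).sub_const a).pow 2).const_mul (m / 2))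
    refine h1.congr_deriv ?_
    simp
    ring
  have hh' : ∀ x, HasDerivAt (fun x => f' x - m * (x - a)) (g x - m) x := by
    intro x
    have h1 := (hf' x).sub (((hasDerivAt_id x).sub_const a).const_mul m)
    refine h1.congr_deriv ?_
    simp
  have hmono : MonotoneOn (fun x => f' x - m * (x - a)) (Set.Icc 0 1) := by
    refine monotoneOn_of_deriv_nonneg (convex_Icc 0 1)
      (fun x _ => (hh' x).continuousAt.continuousWithinAt)
      (fun x _ => (hh' x).differentiableAt.differentiableWithinAt) fun x hx => ?_
    rw [(hh' x).deriv]
    linarith [hg x (interior_subset hx)]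
  suffices f a - m / 2 * (a - a) ^ 2 ≤ f x - m / 2 * (x - a) ^ 2 by
    simp at this
    linarith
  rcases le_total a x with h | h
  · have hm : MonotoneOn (fun x => f x - m / 2 * (x - a) ^ 2) (Set.Icc a x) := by
      refine monotoneOn_of_deriv_nonneg (convex_Icc a x)
        (fun y _ => (hh y).continuousAt.continuousWithinAt)
        (fun y _ => (hh y).differentiableAt.differentiableWithinAt) fun y hy => ?_
      rw [(hh y).deriv]
      have hy' := interior_subset hy
      have := hmono ha ⟨ha.1.trans hy'.1, hy'.2.trans hx.2⟩ hy'.1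
      simpa [hcrit] using this
    exact hm (Set.left_mem_Icc.2 h) (Set.right_mem_Icc.2 h) h
  · have hm : AntitoneOn (fun x => f x - m / 2 * (x - a) ^ 2) (Set.Icc x a) := by
      refine antitoneOn_of_deriv_nonpos (convex_Icc x a)
        (fun y _ => (hh y).continuousAt.continuousWithinAt)
        (fun y _ => (hh y).differentiableAt.differentiableWithinAt) fun y hy => ?_
      rw [(hh y).deriv]
      have hy' := interior_subset hy
      have := hmono ⟨hx.1.trans hy'.1, hy'.2.trans ha.2⟩ ha hy'.2
      simpa [hcrit] using this
    exact hm (Set.left_mem_Icc.2 h) (Set.right_mem_Icc.2 h) h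

variable {ι : Type*} [Fintype ι]

/-- Log-likelihood ratio of `⨂ Bern(q j)` to `⨂ Bern(p j)`. -/
def llr (p q : ι → ℝ) (x : ι → Bool) : ℝ :=
  ∑ j, (llrZero (p j) (q j) + if x j then llrSlope (p j) (q j) else 0)

/-- Logarithm of the Chernoff `a`-coefficient of two product Bernoulli laws. -/
def sumLogCoeff (p q : ι → ℝ) (a : ℝ) : ℝ := ∑ j, logCoeff (p j) (q j) a

variable {p q : ι → ℝ} (hp : ∀ j, 0 < p j ∧ p j < 1) (hq : ∀ j, 0 < q j ∧ q j < 1)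
include hp

theorem bernPMF_tilt_mul (a : ℝ) (x : ι → Bool) :
    bernPMF (fun j => tilt (p j) (q j) a) x * Real.exp (sumLogCoeff p q a) =
      bernPMF p x * Real.exp (a * llr p q x) := by
  unfold bernPMF sumLogCoeff llr
  rw [Real.exp_sum, Finset.mul_sum, Real.exp_sum, ← Finset.prod_mul_distrib,
    ← Finset.prod_mul_distrib]
  refine Finset.prod_congr rfl fun j _ => ?_
  split_ifs
  · exact tilt_mul_exp_logCoeff (hp j).1 (hp j).2 a
  · rw [one_sub_tilt_mul_exp_logCoeff (hp j).1 (hp j).2 a, add_zero]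

omit hp in
-- The subtracted sum is the tilted mean of `llr`, which is also the derivative of `sumLogCoeff`. At
-- a critical point the centred sum is therefore `llr` itself.
theorem centredSum_tilt (a : ℝ) (x : ι → Bool) :
    centredSum (fun j => tilt (p j) (q j) a) (fun j => llrSlope (p j) (q j)) x =
      llr p q x - ∑ j, (llrZero (p j) (q j) + llrSlope (p j) (q j) * tilt (p j) (q j) a) := by
  unfold centredSum llr
  rw [← Finset.sum_sub_distrib]
  refine Finset.sum_congr rfl fun j _ => ?_
  split_ifs <;> ring

theorem hasDerivAt_sumLogCoeff (a : ℝ) : HasDerivAt (sumLogCoeff p q)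
    (∑ j, (llrZero (p j) (q j) + llrSlope (p j) (q j) * tilt (p j) (q j) a)) a := by
  have := HasDerivAt.fun_sum (u := Finset.univ) fun j _ =>
    hasDerivAt_logCoeff (p := p j) (q := q j) (hp j).1 (hp j).2 a
  exact this

theorem hasDerivAt_sumLogCoeff_deriv (a : ℝ) : HasDerivAt
    (fun a => ∑ j, (llrZero (p j) (q j) + llrSlope (p j) (q j) * tilt (p j) (q j) a))
    (∑ j, llrSlope (p j) (q j) ^ 2 * (tilt (p j) (q j) a * (1 - tilt (p j) (q j) a))) a := by
  refine HasDerivAt.fun_sum fun j _ => ?_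
  have := ((hasDerivAt_tilt (p := p j) (q := q j) (hp j).1 (hp j).2 a).const_mul
    (llrSlope (p j) (q j))).const_add (llrZero (p j) (q j))
  convert this using 1
  ring

include hq

theorem bernPMF_mul_exp_llr (x : ι → Bool) :
    bernPMF p x * Real.exp (llr p q x) = bernPMF q x := by
  unfold bernPMF llr
  rw [Real.exp_sum, ← Finset.prod_mul_distrib]
  refine Finset.prod_congr rfl fun j _ => ?_
  have h0 := exp_llrZero (hp j).2 (hq j).2
  have h1 := exp_llrSlope (hp j).1 (hp j).2 (hq j).1 (hq j).2
  have hp0 := (hp j).1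
  have hp1 : 0 < 1 - p j := by linarith [(hp j).2]
  have hq1 : 0 < 1 - q j := by linarith [(hq j).2]
  split_ifs
  · rw [Real.exp_add, h0, h1]
    field_simp
  · rw [add_zero, h0]
    field_simp

theorem sum_rpow_bernPMF [DecidableEq ι] (a : ℝ) :
    ∑ x, bernPMF p x ^ (1 - a) * bernPMF q x ^ a = Real.exp (sumLogCoeff p q a) := by
  have h1 := sum_bernPMF fun j => tilt (p j) (q j) a
  have h2 := congrArg (· * Real.exp (sumLogCoeff p q a)) h1
  simp only [one_mul, Finset.sum_mul] at h2
  rw [← h2]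
  refine Finset.sum_congr rfl fun x _ => ?_
  have hpos := bernPMF_pos hp x
  rw [bernPMF_tilt_mul hp, ← bernPMF_mul_exp_llr hp hq, Real.mul_rpow hpos.le (Real.exp_nonneg _),
    ← mul_assoc, ← Real.rpow_add hpos, ← Real.exp_mul, mul_comm a,
    sub_add_cancel, Real.rpow_one]

/-- Rolle's theorem: the coefficient at `0` and at `1` is a total mass, so its logarithm vanishes
there. -/
theorem exists_critical_sumLogCoeff : ∃ a ∈ Set.Ioo (0 : ℝ) 1,
    ∑ j, (llrZero (p j) (q j) + llrSlope (p j) (q j) * tilt (p j) (q j) a) = 0 := by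
  refine exists_hasDerivAt_eq_zero zero_lt_one
    (fun x _ => (hasDerivAt_sumLogCoeff (q := q) hp x).continuousAt.continuousWithinAt) ?_
    fun x _ => hasDerivAt_sumLogCoeff hp x
  unfold sumLogCoeff
  rw [Finset.sum_congr rfl fun j _ => logCoeff_zero,
    Finset.sum_congr rfl fun j _ => logCoeff_one (hp j).1 (hp j).2 (hq j).1 (hq j).2]

omit hp hq in
theorem sumLogCoeff_zero : sumLogCoeff p q 0 = 0 :=
  Finset.sum_eq_zero fun _ _ => logCoeff_zero

theorem sumLogCoeff_one : sumLogCoeff p q 1 = 0 :=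
  Finset.sum_eq_zero fun j _ => logCoeff_one (hp j).1 (hp j).2 (hq j).1 (hq j).2

section Bounds

variable {b₀ b₁ a : ℝ} (hb₀ : 0 < b₀) (hb₁ : b₁ < 1) (hpb : ∀ j, b₀ ≤ p j ∧ p j ≤ b₁)
  (hqb : ∀ j, b₀ ≤ q j ∧ q j ≤ b₁) (ha : a ∈ Set.Ioo (0 : ℝ) 1)
  (hcrit : ∑ j, (llrZero (p j) (q j) + llrSlope (p j) (q j) * tilt (p j) (q j) a) = 0)
include hpb hqb

omit [Fintype ι] in
theorem tilt_mem (a : ℝ) (ha : a ∈ Set.Icc (0 : ℝ) 1) (hb₁ : b₁ < 1) (j : ι) :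
    b₀ ≤ tilt (p j) (q j) a ∧ tilt (p j) (q j) a ≤ b₁ :=
  ⟨le_tilt (hp j).1 (hp j).2 (hq j).1 (hq j).2 ha.1 ha.2 (hpb j).1 (hqb j).1,
    tilt_le (hp j).1 (hp j).2 (hq j).1 (hq j).2 ha.1 ha.2 (hpb j).2 (hqb j).2 hb₁⟩

include hb₀ hb₁ ha hcrit

/-- The second derivative is the tilted variance of `llr`, and tilted parameters remain in `[b₀,
b₁]`. -/
theorem sumLogCoeff_lower {x : ℝ} (hx : x ∈ Set.Icc (0 : ℝ) 1) :
    sumLogCoeff p q a + b₀ * (1 - b₁) * (∑ j, llrSlope (p j) (q j) ^ 2) / 2 * (x - a) ^ 2 ≤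
      sumLogCoeff p q x := by
  refine add_sq_le_of_deriv2_ge (hasDerivAt_sumLogCoeff hp) (hasDerivAt_sumLogCoeff_deriv hp)
    (fun y hy => ?_) (Set.Ioo_subset_Icc_self ha) hcrit hx
  rw [Finset.mul_sum]
  refine Finset.sum_le_sum fun j _ => ?_
  obtain ⟨h1, h2⟩ := tilt_mem hp hq hpb hqb y hy hb₁ j
  rw [mul_comm]
  gcongr
  linarith

theorem sumLogCoeff_upper {x : ℝ} (hx : x ∈ Set.Icc (0 : ℝ) 1) :
    sumLogCoeff p q x ≤
      sumLogCoeff p q a + b₁ * (∑ j, llrSlope (p j) (q j) ^ 2) / 2 * (x - a) ^ 2 := by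
  have := add_sq_le_of_deriv2_ge (m := -(b₁ * ∑ j, llrSlope (p j) (q j) ^ 2))
    (fun y => (hasDerivAt_sumLogCoeff (q := q) hp y).neg)
    (fun y => (hasDerivAt_sumLogCoeff_deriv (q := q) hp y).neg)
    (fun y hy => ?_) (Set.Ioo_subset_Icc_self ha) (by rw [hcrit, neg_zero]) hx
  · simp only [Pi.neg_apply] at this
    linarith
  · rw [neg_le_neg_iff, Finset.mul_sum]
    refine Finset.sum_le_sum fun j _ => ?_
    obtain ⟨h1, h2⟩ := tilt_mem hp hq hpb hqb y hy hb₁ j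
    rw [mul_comm b₁]
    gcongr
    nlinarith

/-- The Chernoff information is attained at the critical point. -/
theorem chernoffInfo_eq [DecidableEq ι] :
    chernoffInfo (bernPMF p) (bernPMF q) = -sumLogCoeff p q a := by
  have hdiv : ∀ x : ℝ, chernoffDiv x (bernPMF p) (bernPMF q) = -sumLogCoeff p q x := fun x => by
    rw [chernoffDiv, ← Real.log_exp (sumLogCoeff p q x), ← sum_rpow_bernPMF hp hq]
  have hle : ∀ x : Set.Ioo (0 : ℝ) 1, chernoffDiv (x : ℝ) (bernPMF p) (bernPMF q) ≤
      -sumLogCoeff p q a := fun x => by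
    rw [hdiv, neg_le_neg_iff]
    refine le_trans (le_add_of_nonneg_right ?_)
      (sumLogCoeff_lower hp hq hb₀ hb₁ hpb hqb ha hcrit (Set.Ioo_subset_Icc_self x.2))
    have : 0 < 1 - b₁ := by linarith
    positivity
  have : Nonempty (Set.Ioo (0 : ℝ) 1) := ⟨⟨a, ha⟩⟩
  refine le_antisymm (ciSup_le hle) ?_
  rw [← hdiv]
  exact le_ciSup (f := fun x : Set.Ioo (0 : ℝ) 1 => chernoffDiv (x : ℝ) (bernPMF p) (bernPMF q))
    ⟨_, Set.forall_mem_range.2 hle⟩ ⟨a, ha⟩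

theorem chernoffInfo_le [DecidableEq ι] :
    chernoffInfo (bernPMF p) (bernPMF q) ≤ b₁ * (∑ j, llrSlope (p j) (q j) ^ 2) / 2 * a ^ 2 := by
  have := sumLogCoeff_upper hp hq hb₀ hb₁ hpb hqb ha hcrit (x := 0) (by simp)
  rw [sumLogCoeff_zero] at this
  rw [chernoffInfo_eq hp hq hb₀ hb₁ hpb hqb ha hcrit]
  linarith

/-- The optimal exponent stays away from `0` and `1`. -/
theorem critical_mem (hb : b₀ ≤ b₁) (hW : 0 < ∑ j, llrSlope (p j) (q j) ^ 2) :
    b₀ * (1 - b₁) / (b₀ * (1 - b₁) + b₁) ≤ a ∧ a ≤ 1 - b₀ * (1 - b₁) / (b₀ * (1 - b₁) + b₁) := by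
  have u0 := sumLogCoeff_upper hp hq hb₀ hb₁ hpb hqb ha hcrit (x := 0) (by simp)
  have u1 := sumLogCoeff_upper hp hq hb₀ hb₁ hpb hqb ha hcrit (x := 1) (by simp)
  have l0 := sumLogCoeff_lower hp hq hb₀ hb₁ hpb hqb ha hcrit (x := 0) (by simp)
  have l1 := sumLogCoeff_lower hp hq hb₀ hb₁ hpb hqb ha hcrit (x := 1) (by simp)
  rw [sumLogCoeff_zero] at u0 l0
  rw [sumLogCoeff_one hp hq] at u1 l1
  have hm : 0 < b₀ * (1 - b₁) := mul_pos hb₀ (by linarith)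
  have hmb : b₀ * (1 - b₁) ≤ b₁ := by nlinarith
  obtain ⟨ha0, ha1⟩ := ha
  generalize (∑ j, llrSlope (p j) (q j) ^ 2) = W at *
  generalize b₀ * (1 - b₁) = m at *
  -- The Taylor bounds at the two endpoints, where the function vanishes, compare `a²` with `(1 -
  -- a)²`. Since `m ≤ b₁`, this becomes a linear comparison without square roots.
  have key : ∀ s t : ℝ, 0 ≤ s → 0 ≤ t → m * s ^ 2 ≤ b₁ * t ^ 2 → m * s ≤ b₁ * t := by
    intro s t hs ht h
    refine abs_le_of_sq_le_sq' ?_ (mul_nonneg (by linarith) ht) |>.2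
    calc (m * s) ^ 2 = m * (m * s ^ 2) := by ring
      _ ≤ b₁ * (b₁ * t ^ 2) := by gcongr; linarith
      _ = (b₁ * t) ^ 2 := by ring
  have k1 : m * (1 - a) ^ 2 ≤ b₁ * a ^ 2 := by
    have h2 : W * (m * (1 - a) ^ 2) ≤ W * (b₁ * a ^ 2) := by nlinarith
    exact le_of_mul_le_mul_left h2 hW
  have k2 : m * a ^ 2 ≤ b₁ * (1 - a) ^ 2 := by
    have h2 : W * (m * a ^ 2) ≤ W * (b₁ * (1 - a) ^ 2) := by nlinarith
    exact le_of_mul_le_mul_left h2 hW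
  have j1 := key (1 - a) a (by linarith) ha0.le k1
  have j2 := key a (1 - a) ha0.le (by linarith) k2
  have hden : 0 < m + b₁ := by linarith
  constructor
  · rw [div_le_iff₀ hden]
    linarith
  · rw [le_sub_comm, div_le_iff₀ hden]
    linarith

/-- With `L = llr p q x`, the minimum is `φ_p min(1, e^L)`, and `φ_p = e^{-D^*} φ_tilt e^{-aL}` at
the critical `a`. -/
theorem bernPMF_min_eq [DecidableEq ι] (x : ι → Bool) :
    min (bernPMF p x) (bernPMF q x) =
      Real.exp (-chernoffInfo (bernPMF p) (bernPMF q)) *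
        (bernPMF (fun j => tilt (p j) (q j) a) x * Real.exp (-max
          (a * centredSum (fun j => tilt (p j) (q j) a) (fun j => llrSlope (p j) (q j)) x)
          ((a - 1) * centredSum (fun j => tilt (p j) (q j) a)
            (fun j => llrSlope (p j) (q j)) x))) := by
  rw [centredSum_tilt, hcrit, sub_zero, chernoffInfo_eq hp hq hb₀ hb₁ hpb hqb ha hcrit, neg_neg,
    ← mul_assoc, mul_comm (Real.exp _), bernPMF_tilt_mul hp, ← bernPMF_mul_exp_llr hp hq,
    mul_assoc, ← Real.exp_add]
  have hpos := bernPMF_pos hp x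
  generalize llr p q x = t
  rcases le_total t 0 with h | h
  · rw [max_eq_right (by nlinarith), min_eq_right]
    · congr 2; ring
    · exact mul_le_of_le_one_right hpos.le (Real.exp_le_one_iff.2 h)
  · rw [max_eq_left (by nlinarith), min_eq_left]
    · simp
    · exact le_mul_of_one_le_right hpos.le (Real.one_le_exp h)

theorem le_tvAffinity_bernPMF [DecidableEq ι] :
    Real.exp (-chernoffInfo (bernPMF p) (bernPMF q)) *
      ∑ x, bernPMF (fun j => tilt (p j) (q j) a) x * Real.exp (-|centredSum
        (fun j => tilt (p j) (q j) a) (fun j => llrSlope (p j) (q j)) x|) ≤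
      tvAffinity (bernPMF p) (bernPMF q) := by
  unfold tvAffinity
  rw [Finset.mul_sum]
  refine Finset.sum_le_sum fun x _ => ?_
  rw [bernPMF_min_eq hp hq hb₀ hb₁ hpb hqb ha hcrit]
  refine mul_le_mul_of_nonneg_left (mul_le_mul_of_nonneg_left ?_
    (bernPMF_nonneg (fun j => ?_) x)) (Real.exp_nonneg _)
  · rw [Real.exp_le_exp, neg_le_neg_iff]
    obtain ⟨ha0, ha1⟩ := ha
    generalize centredSum _ _ x = t
    refine max_le ?_ ?_
    · rcases abs_cases t with h | h <;> nlinarith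
    · rcases abs_cases t with h | h <;> nlinarith
  · obtain ⟨h1, h2⟩ := tilt_mem hp hq hpb hqb a (Set.Ioo_subset_Icc_self ha) hb₁ j
    constructor <;> linarith

theorem tvAffinity_bernPMF_le [DecidableEq ι] {κ : ℝ} (h1 : κ ≤ a) (h2 : a ≤ 1 - κ) :
    tvAffinity (bernPMF p) (bernPMF q) ≤ Real.exp (-chernoffInfo (bernPMF p) (bernPMF q)) *
      ∑ x, bernPMF (fun j => tilt (p j) (q j) a) x * Real.exp (-(κ * |centredSum
        (fun j => tilt (p j) (q j) a) (fun j => llrSlope (p j) (q j)) x|)) := by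
  unfold tvAffinity
  rw [Finset.mul_sum]
  refine Finset.sum_le_sum fun x _ => ?_
  rw [bernPMF_min_eq hp hq hb₀ hb₁ hpb hqb ha hcrit]
  refine mul_le_mul_of_nonneg_left (mul_le_mul_of_nonneg_left ?_
    (bernPMF_nonneg (fun j => ?_) x)) (Real.exp_nonneg _)
  · rw [Real.exp_le_exp, neg_le_neg_iff]
    generalize centredSum _ _ x = t
    rcases abs_cases t with h | h
    · exact le_max_of_le_left (by nlinarith)
    · exact le_max_of_le_right (by nlinarith)
  · obtain ⟨h1, h2⟩ := tilt_mem hp hq hpb hqb a (Set.Ioo_subset_Icc_self ha) hb₁ j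
    constructor <;> linarith

end Bounds

end Tilting

/-! ### The sharp rate -/

section Rate

theorem abs_log_odds_eq (p q : ℝ) :
    |Real.log (p * (1 - q) / (q * (1 - p)))| = |llrSlope p q| := by
  unfold llrSlope
  rw [← abs_neg, ← Real.log_inv, inv_div]

theorem llrSlope_le {p q b ε ω : ℝ} (hε : 0 < ε) (hω : 0 < ω) (hb : 0 < b) (hb1 : b ≤ 1 - ε)
    (hp : b / ω ≤ p ∧ p ≤ b) (hq : b / ω ≤ q ∧ q ≤ b) : llrSlope p q ≤ ω / ε := by
  have hbω : 0 < b / ω := by positivity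
  have hp0 : 0 < p := by linarith
  have hq0 : 0 < q := by linarith
  have hp1 : 0 < 1 - p := by linarith
  have hq1 : 0 < 1 - q := by linarith
  have hpω : b ≤ p * ω := (div_le_iff₀ hω).1 hp.1
  have hx : 0 < q * (1 - p) / (p * (1 - q)) := by positivity
  refine (Real.log_le_sub_one_of_pos hx).trans ?_
  suffices q * (1 - p) / (p * (1 - q)) ≤ ω / ε by linarith
  rw [div_le_div_iff₀ (by positivity) hε]
  calc q * (1 - p) * ε ≤ q * 1 * ε := by gcongr; linarith
    _ ≤ (p * ω) * 1 * (1 - q) := by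
      rw [mul_one, mul_one]
      gcongr <;> linarith
    _ = ω * (p * (1 - q)) := by ring

theorem abs_llrSlope_le {p q b ε ω : ℝ} (hε : 0 < ε) (hω : 0 < ω) (hb : 0 < b) (hb1 : b ≤ 1 - ε)
    (hp : b / ω ≤ p ∧ p ≤ b) (hq : b / ω ≤ q ∧ q ≤ b) : |llrSlope p q| ≤ ω / ε := by
  refine abs_le'.2 ⟨llrSlope_le hε hω hb hb1 hp hq, ?_⟩
  have : -llrSlope p q = llrSlope q p := by
    unfold llrSlope
    rw [← Real.log_inv, inv_div]
  rw [this]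
  exact llrSlope_le hε hω hb hb1 hq hp

theorem exists_maxLogOdds_eq {n : ℕ} [NeZero n] (p q : Fin n → ℝ) :
    ∃ j, maxLogOdds p q = |llrSlope (p j) (q j)| ∧
      ∀ j', |llrSlope (p j') (q j')| ≤ |llrSlope (p j) (q j)| := by
  have he : maxLogOdds p q = ⨆ j, |llrSlope (p j) (q j)| := by
    unfold maxLogOdds
    simp only [abs_log_odds_eq]
  obtain ⟨j, hj⟩ := exists_eq_ciSup_of_finite (f := fun j => |llrSlope (p j) (q j)|)
  refine ⟨j, he.trans hj.symm, fun j' => ?_⟩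
  rw [hj]
  exact le_ciSup (f := fun j => |llrSlope (p j) (q j)|) (Set.finite_range _).bddAbove j'

/-- Sharp asymptotics of the affinity of two product Bernoulli laws with comparable parameters, each
pair of which is shared by a positive fraction of the coordinates. -/
theorem exists_tvAffinity_rate {c ε ω : ℝ} (hc : 0 < c) (hε : 0 < ε) (hω : 1 < ω) :
    ∃ C₁ c₁ c₂ : ℝ, 0 < C₁ ∧ 0 < c₁ ∧ 0 < c₂ ∧ ∀ (n : ℕ) (p q : Fin n → ℝ) (b : ℝ),
      0 < b → b ≤ 1 - ε → (∀ j, b / ω ≤ p j ∧ p j ≤ b) → (∀ j, b / ω ≤ q j ∧ q j ≤ b) →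
      (∀ j, c * n ≤ #{j' | p j' = p j ∧ q j' = q j}) → C₁ ≤ n * b →
      n * b ≤ chernoffInfo (bernPMF p) (bernPMF q) ^ 2 →
      c₁ * ((Real.sqrt (n * b) * maxLogOdds p q)⁻¹ *
        Real.exp (-chernoffInfo (bernPMF p) (bernPMF q))) ≤ tvAffinity (bernPMF p) (bernPMF q) ∧
      tvAffinity (bernPMF p) (bernPMF q) ≤ c₂ * ((Real.sqrt (n * b) * maxLogOdds p q)⁻¹ *
        Real.exp (-chernoffInfo (bernPMF p) (bernPMF q))) := by
  have hω0 : 0 < ω := by linarith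
  -- With `X = n b`, the block variance satisfies `c₀ X ≤ s² ≤ X`: the block has at least `c n`
  -- coordinates, with tilted parameter at least `b/ω` and at most `1 - ε`.
  obtain ⟨c₀, hc₀⟩ : ∃ c₀, c₀ = c * ε / ω := ⟨_, rfl⟩
  have hc₀pos : 0 < c₀ := by rw [hc₀]; positivity
  -- Chosen so that `τ² c₀ ≥ 2`, which puts twice the total variance below `(|λ| τ s)²`.
  obtain ⟨τ, hτdef⟩ : ∃ τ, τ = 2 / c₀ + 1 := ⟨_, rfl⟩
  have hτ : 0 < τ := by rw [hτdef]; positivity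
  have hτ2 : 2 ≤ τ ^ 2 * c₀ := by
    have h1 : τ ^ 2 * c₀ = 2 * (2 / c₀) + 4 + c₀ := by rw [hτdef]; field_simp; ring
    have h2 : 0 < 2 / c₀ := by positivity
    linarith
  -- For parameters in `[b/ω, b]`, `critical_mem` gives the margin `(1 - b) / (1 - b + ω)`, which is
  -- at least this `κ`.
  obtain ⟨κ, hκdef⟩ : ∃ κ, κ = ε / (ε + ω) := ⟨_, rfl⟩
  have hκ : 0 < κ := by rw [hκdef]; positivity
  -- The first term of `C₁` makes `s ≥ 4 (τ + 2)`; the second turns `4 X ≤ (X λ²)²` into `c₀ X λ² ≥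
  -- 1`, hence `|λ| s ≥ 1`.
  refine ⟨16 * (τ + 2) ^ 2 / c₀ + 1 / (4 * c₀ ^ 2),
    Real.exp (-(8 * (τ + 2) ^ 2)) * Real.exp (-(ω / ε + 1)) / 20,
    4 * Real.exp 16 * (1 + κ * (ω / ε)) / (κ * Real.sqrt c₀), by positivity, by positivity,
    by positivity, ?_⟩
  intro n p q b hb hb1 hpb hqb hcard hX hXD
  obtain ⟨X, hXdef⟩ : ∃ X, X = n * b := ⟨_, rfl⟩
  rw [← hXdef] at hX hXD ⊢
  have hX1 : 16 * (τ + 2) ^ 2 ≤ c₀ * X := by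
    have : 16 * (τ + 2) ^ 2 / c₀ ≤ X := by
      refine le_trans ?_ hX
      have : 0 < 1 / (4 * c₀ ^ 2) := by positivity
      linarith
    rw [div_le_iff₀ hc₀pos] at this
    linarith
  have hX2 : 1 ≤ 4 * c₀ ^ 2 * X := by
    have : 1 / (4 * c₀ ^ 2) ≤ X := by
      refine le_trans ?_ hX
      have : 0 < 16 * (τ + 2) ^ 2 / c₀ := by positivity
      linarith
    rw [div_le_iff₀ (by positivity)] at this
    linarith
  have hX0 : 0 < X := (mul_pos_iff_of_pos_left hc₀pos).1 (lt_of_lt_of_le (by positivity) hX1)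
  have hn : NeZero n := ⟨by rintro rfl; simp at hXdef; linarith⟩
  have hbω : 0 < b / ω := by positivity
  have hblt : b < 1 := by linarith
  have hp : ∀ j, 0 < p j ∧ p j < 1 := fun j => ⟨hbω.trans_le (hpb j).1, (hpb j).2.trans_lt hblt⟩
  have hq : ∀ j, 0 < q j ∧ q j < 1 := fun j => ⟨hbω.trans_le (hqb j).1, (hqb j).2.trans_lt hblt⟩
  obtain ⟨a, ha, hcrit⟩ := exists_critical_sumLogCoeff hp hq
  obtain ⟨j₀, hj₀, hmax⟩ := exists_maxLogOdds_eq p q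
  rw [hj₀]
  have htilt := tilt_mem hp hq hpb hqb a (Set.Ioo_subset_Icc_self ha) hblt
  have hlow := le_tvAffinity_bernPMF hp hq hbω hblt hpb hqb ha hcrit
  have hD := chernoffInfo_le hp hq hbω hblt hpb hqb ha hcrit
  have hD0 : 0 ≤ chernoffInfo (bernPMF p) (bernPMF q) := by
    have h := sumLogCoeff_lower hp hq hbω hblt hpb hqb ha hcrit (x := 0) (by simp)
    rw [sumLogCoeff_zero] at h
    rw [chernoffInfo_eq hp hq hbω hblt hpb hqb ha hcrit]
    have h1 : 0 < 1 - b := by linarith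
    have h2 : 0 ≤ b / ω * (1 - b) * (∑ j, llrSlope (p j) (q j) ^ 2) / 2 * (0 - a) ^ 2 := by
      positivity
    linarith
  have hcm := critical_mem hp hq hbω hblt hpb hqb ha hcrit (div_le_self hb.le hω.le)
  have hup := fun κ h1 h2 => tvAffinity_bernPMF_le hp hq hbω hblt hpb hqb ha hcrit (κ := κ) h1 h2
  generalize chernoffInfo (bernPMF p) (bernPMF q) = D at *
  have hMlam := abs_llrSlope_le hε hω0 hb hb1 (hpb j₀) (hqb j₀)
  obtain ⟨lam, hlam⟩ : ∃ lam, lam = llrSlope (p j₀) (q j₀) := ⟨_, rfl⟩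
  obtain ⟨r, hr⟩ : ∃ r, r = tilt (p j₀) (q j₀) a := ⟨_, rfl⟩
  rw [← hlam] at hmax hMlam ⊢
  have hsq : ∀ j, llrSlope (p j) (q j) ^ 2 ≤ lam ^ 2 := fun j => sq_le_sq.2 (hmax j)
  have hW : ∑ j, llrSlope (p j) (q j) ^ 2 ≤ n * lam ^ 2 :=
    (Finset.sum_le_sum fun j _ => hsq j).trans (by simp)
  have hDX : D ≤ X * lam ^ 2 / 2 := by
    refine hD.trans ?_
    have ha2 : a ^ 2 ≤ 1 := pow_le_one₀ ha.1.le ha.2.le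
    have hW0 : 0 ≤ ∑ j, llrSlope (p j) (q j) ^ 2 := Finset.sum_nonneg fun j _ => sq_nonneg _
    calc b * (∑ j, llrSlope (p j) (q j) ^ 2) / 2 * a ^ 2
        ≤ b * (∑ j, llrSlope (p j) (q j) ^ 2) / 2 * 1 := by gcongr
      _ ≤ b * (n * lam ^ 2) / 2 * 1 := by gcongr
      _ = X * lam ^ 2 / 2 := by rw [hXdef]; ring
  -- The only use of `X ≤ D²`: a large Chernoff information excludes a small `λ`.
  have hXlam : 4 * X ≤ (X * lam ^ 2) ^ 2 := by
    have := pow_le_pow_left₀ hD0 hDX 2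
    linarith
  have hlne : lam ≠ 0 := by
    rintro rfl
    simp at hXlam
    linarith
  have hWpos : 0 < ∑ j, llrSlope (p j) (q j) ^ 2 := by
    refine lt_of_lt_of_le ?_ (Finset.single_le_sum (f := fun j => llrSlope (p j) (q j) ^ 2)
      (fun j _ => sq_nonneg _) (Finset.mem_univ j₀))
    simp only [← hlam]
    positivity
  have hl0 : 0 < |lam| := abs_pos.2 hlne
  have hrb : b / ω ≤ r ∧ r ≤ b := hr ▸ htilt j₀
  have hr0 : 0 < r := by linarith
  have hr1 : r < 1 := by linarith
  have hκle : κ ≤ b / ω * (1 - b) / (b / ω * (1 - b) + b) := by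
    have h1b : 0 < 1 - b := by linarith
    rw [hκdef, div_le_div_iff₀ (by positivity) (by positivity)]
    have h1 : 0 ≤ b * (1 - b - ε) := mul_nonneg hb.le (by linarith)
    have h2 : b / ω * (1 - b) * (ε + ω) - ε * (b / ω * (1 - b) + b) = b * (1 - b - ε) := by
      field_simp; ring
    linarith
  obtain ⟨hκ1, hκ2⟩ := hcm hWpos
  have hup := hup κ (hκle.trans hκ1) (by linarith)
  classical
  let A : Fin n → Prop := fun j => p j = p j₀ ∧ q j = q j₀
  obtain ⟨N, hN⟩ : ∃ N, N = Fintype.card {j // A j} := ⟨_, rfl⟩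
  have hNlow : c * n ≤ N := by
    rw [hN, Fintype.card_subtype]
    exact hcard j₀
  have hNup : (N : ℝ) ≤ n := by
    rw [hN]
    exact_mod_cast (Fintype.card_subtype_le A).trans (Fintype.card_fin n).le
  have hVpos : 0 ≤ N * r * (1 - r) := mul_nonneg (by positivity) (by linarith)
  obtain ⟨s, hs⟩ : ∃ s, s = Real.sqrt (N * r * (1 - r)) := ⟨_, rfl⟩
  have hs0 : 0 ≤ s := hs ▸ Real.sqrt_nonneg _
  have hV : s ^ 2 = N * r * (1 - r) := by rw [hs, Real.sq_sqrt hVpos]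
  have hslow : c₀ * X ≤ s ^ 2 := by
    rw [hV]
    calc c₀ * X = c * n * (b / ω) * ε := by rw [hc₀, hXdef]; ring
      _ ≤ N * r * (1 - r) := by
        gcongr
        · exact hrb.1
        · linarith
  have hsup : s ^ 2 ≤ X := by
    rw [hV, hXdef]
    calc (N : ℝ) * r * (1 - r) ≤ n * b * 1 := by
          gcongr
          all_goals linarith [hrb.2]
      _ = n * b := mul_one _
  have hs4 : 4 * (τ + 2) ≤ s := by
    refine abs_le_of_sq_le_sq' ?_ hs0 |>.2
    calc (4 * (τ + 2)) ^ 2 = 16 * (τ + 2) ^ 2 := by ring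
      _ ≤ s ^ 2 := hX1.trans hslow
  have hspos : 0 < s := by linarith
  have hlams : 1 ≤ |lam| * s := by
    have h1 : 1 ≤ (c₀ * (X * lam ^ 2)) ^ 2 := by
      rw [mul_pow]
      have := mul_le_mul_of_nonneg_left hXlam (sq_nonneg c₀)
      linarith
    have h2 : 1 ≤ c₀ * (X * lam ^ 2) := (one_le_sq_iff₀ (by positivity)).1 h1
    have h3 : (1 : ℝ) ^ 2 ≤ (|lam| * s) ^ 2 := by
      rw [mul_pow, sq_abs]
      linarith [mul_le_mul_of_nonneg_left hslow (sq_nonneg lam)]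
    exact abs_le_of_sq_le_sq' h3 (by positivity) |>.2
  have htA : ∀ j, A j → tilt (p j) (q j) a = r := fun j hj => by rw [hj.1, hj.2, hr]
  have hlA : ∀ j, A j → llrSlope (p j) (q j) = lam := fun j hj => by rw [hj.1, hj.2, hlam]
  have ht01 : ∀ j, 0 ≤ tilt (p j) (q j) a ∧ tilt (p j) (q j) a ≤ 1 := fun j =>
    ⟨by linarith [(htilt j).1], by linarith [(htilt j).2]⟩
  have hvar : 2 * ∑ j, llrSlope (p j) (q j) ^ 2 * (tilt (p j) (q j) a * (1 - tilt (p j) (q j) a)) ≤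
      (|lam| * (τ * s)) ^ 2 := by
    have h1 : ∑ j, llrSlope (p j) (q j) ^ 2 * (tilt (p j) (q j) a * (1 - tilt (p j) (q j) a)) ≤
        lam ^ 2 * X := by
      calc _ ≤ ∑ _j : Fin n, lam ^ 2 * b := by
            refine Finset.sum_le_sum fun j _ => mul_le_mul (hsq j) ?_
              (mul_nonneg (ht01 j).1 (sub_nonneg.2 (ht01 j).2)) (sq_nonneg _)
            exact (mul_le_of_le_one_right (ht01 j).1 (by linarith [(ht01 j).1])).trans (htilt j).2
        _ = lam ^ 2 * X := by rw [hXdef]; simp; ring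
    have h2 : 2 * X ≤ τ ^ 2 * s ^ 2 := by
      have h3 := mul_le_mul_of_nonneg_right hτ2 hX0.le
      have h4 := mul_le_mul_of_nonneg_left hslow (sq_nonneg τ)
      linarith
    calc _ ≤ 2 * (lam ^ 2 * X) := by linarith
      _ = lam ^ 2 * (2 * X) := by ring
      _ ≤ lam ^ 2 * (τ ^ 2 * s ^ 2) := by gcongr
      _ = (|lam| * (τ * s)) ^ 2 := by rw [mul_pow, sq_abs]; ring
  rw [hN] at hV
  have hE1 := le_sum_bernPMF_exp (A := A) ht01 hr0 hr1 htA hlA hV hτ hs4 hlams hMlam hvar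
  have hE2 := sum_bernPMF_exp_le (A := A) ht01 hr0 hr1 htA hlA hV (by linarith) hκ hlne
  have hsX : s ≤ Real.sqrt X := Real.le_sqrt_of_sq_le hsup
  have hsX' : Real.sqrt c₀ * Real.sqrt X ≤ s := by
    rw [← Real.sqrt_mul hc₀pos.le]
    exact Real.sqrt_le_iff.2 ⟨hs0, hslow⟩
  have hsqX : 0 < Real.sqrt X := Real.sqrt_pos.2 hX0
  have hsqc : 0 < Real.sqrt c₀ := Real.sqrt_pos.2 hc₀pos
  constructor
  · refine le_trans ?_ hlow
    calc _ = Real.exp (-D) * (1 / 2 * (Real.exp (-(8 * (τ + 2) ^ 2)) / (10 * Real.sqrt X) *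
          Real.exp (-(ω / ε + 1)) / |lam|)) := by
          field_simp
          ring
      _ ≤ Real.exp (-D) * (1 / 2 * (Real.exp (-(8 * (τ + 2) ^ 2)) / (10 * s) *
          Real.exp (-(ω / ε + 1)) / |lam|)) := by gcongr
      _ ≤ _ := by gcongr
  · refine hup.trans ?_
    calc _ ≤ Real.exp (-D) * (2 * Real.exp 16 / s * (2 * ((1 + κ * |lam|) / (κ * |lam|)))) := by
          gcongr
      _ ≤ Real.exp (-D) * (2 * Real.exp 16 / (Real.sqrt c₀ * Real.sqrt X) *
          (2 * ((1 + κ * (ω / ε)) / (κ * |lam|)))) := by gcongr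
      _ = _ := by
          field_simp
          ring

end Rate

end

theorem mainTheorem4 :
    -- The error is half the affinity of the two hypotheses on the row of node `i`; putting back the
    -- diagonal entry changes the affinity at most by a factor in `[ε, 1]`.
    (∀ (n K : ℕ) (P : Matrix (Fin K) (Fin K) ℝ) (z : Fin n → Fin K) (i : Fin n) (k l : Fin K)
        (zhat : Matrix (Fin n) (Fin n) Bool → Fin K),
      P.IsSymm → (∀ a b, 0 ≤ P a b ∧ P a b ≤ 1) → k ≠ l → (z i = k ∨ z i = l) →
      IsBayesEstimator P z i k l zhat →
        labelError P z i k l zhat =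
          (1 / 2) * tvAffinity (bernPMF (paramVecErase P z i k)) (bernPMF (paramVecErase P z i l)) ∧
        ∀ ε : ℝ, 0 < ε → maxEntry P ≤ 1 - ε →
          (1 / 2) * tvAffinity (bernPMF (paramVec P z k)) (bernPMF (paramVec P z l)) ≤
            labelError P z i k l zhat ∧
          labelError P z i k l zhat ≤
            ε⁻¹ * ((1 / 2) * tvAffinity (bernPMF (paramVec P z k)) (bernPMF (paramVec P z l)))) ∧
    -- The sharp rate, with constants that depend on `β`, `ε`, `ω` and `Kstar` only.
    (∀ (β ε ω : ℝ) (Kstar : ℕ), 1 < β → 0 < ε → ε < 1 → 1 < ω →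
      ∃ C₁ C₂ c₁ c₂ : ℝ, 0 < C₁ ∧ 0 < C₂ ∧ 0 < c₁ ∧ 0 < c₂ ∧
        ∀ (n K : ℕ) (P : Matrix (Fin K) (Fin K) ℝ) (z : Fin n → Fin K) (i : Fin n) (k l : Fin K)
          (zhat : Matrix (Fin n) (Fin n) Bool → Fin K),
          K ≤ Kstar → P.IsSymm → (∀ a b, 0 ≤ P a b ∧ P a b ≤ 1) → k ≠ l → (z i = k ∨ z i = l) →
          BlockRegular β ε ω P z →
          IsBayesEstimator P z i k l zhat →
          C₁ ≤ n * maxEntry P →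
          n * maxEntry P ≤
            C₂ * chernoffInfo (bernPMF (paramVec P z k)) (bernPMF (paramVec P z l)) ^ 2 →
          c₁ * errorRate P z k l ≤ labelError P z i k l zhat ∧
            labelError P z i k l zhat ≤ c₂ * errorRate P z k l) := by
  refine ⟨?_, ?_⟩
  · intro n K P z i k l zhat hP h01 hkl _ hz
    have hL := labelError_eq hP h01 hkl hz
    refine ⟨hL, fun ε hε hmax => ?_⟩
    rw [hL]
    refine ⟨mul_le_mul_of_nonneg_left (tvAffinity_paramVec_le P z i k l) (by norm_num), ?_⟩
    rw [inv_mul_eq_div, le_div_iff₀ hε]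
    linarith [le_tvAffinity_paramVec z i k l h01 hmax]
  · intro β ε ω Kstar hβ hε _ hω
    obtain ⟨C₁, c₁, c₂, hC₁, hc₁, hc₂, H⟩ := exists_tvAffinity_rate
      -- `Kstar + 1` keeps the denominator positive even when `Kstar = 0`.
      (c := 1 / (β * (Kstar + 1))) (by positivity) hε hω
    refine ⟨C₁, 1, c₁ / 2, c₂ / (2 * ε), hC₁, one_pos, by positivity, by positivity, ?_⟩
    intro n K P z i k l zhat hK hP h01 hkl _ hreg hz hX hXD
    have hmin := hreg.min_pos
    have hb : 0 < maxEntry P := hmin.trans_le ((minEntry_le P k l).trans (le_maxEntry P k l))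
    have hratio : maxEntry P / ω ≤ minEntry P :=
      (div_le_comm₀ hmin (by linarith)).1 hreg.ratio_le
    have hpar : ∀ a j, maxEntry P / ω ≤ paramVec P z a j ∧ paramVec P z a j ≤ maxEntry P :=
      fun a j => ⟨hratio.trans (minEntry_le P _ _), le_maxEntry P _ _⟩
    have hK0 : (0 : ℝ) < K := by exact_mod_cast k.pos
    have hKs : (K : ℝ) ≤ Kstar + 1 := by exact_mod_cast hK.trans (Nat.le_succ _)
    obtain ⟨h1, h2⟩ := H n (paramVec P z k) (paramVec P z l) (maxEntry P) hb hreg.max_le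
      (hpar k) (hpar l) (fun j => by
        calc 1 / (β * (Kstar + 1)) * (n : ℝ) ≤ 1 / (β * K) * n := by gcongr
          _ = n / (β * K) := by ring
          -- Nodes with the label of `j` share both parameters with `j`.
          _ ≤ classSize z (z j) := hreg.size_lower (z j)
          _ ≤ _ := by
            unfold classSize
            exact_mod_cast Finset.card_le_card fun j' hj' => by
              simp only [Finset.mem_filter, Finset.mem_univ, true_and] at hj' ⊢
              simp [paramVec, hj']) hX (by rwa [one_mul] at hXD)
    have hlow := tvAffinity_paramVec_le P z i k l
    have hup := le_tvAffinity_paramVec z i k l h01 hreg.max_le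
    rw [labelError_eq hP h01 hkl hz]
    unfold errorRate
    constructor
    · linarith
    · rw [div_mul_eq_mul_div c₂, le_div_iff₀ (by positivity)]
      linarith
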